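/- Let $G$ be a finite simple graph with vertices $v_1,\dots,v_m$. A configuration on $G$ is a function $C:V(G)\to\mathbb{N}\cup\{0\}$, where $C(v)$ is the number of pebbles on $v$. A pebbling move removes two pebbles from a vertex that carries at least two pebbles and places one pebble on an adjacent vertex. $C$ is cover solvable on $G$ if some finite sequence of pebbling moves leads from $C$ to a configuration with at least one pebble on every vertex simultaneously. Encode a pair $(G,C)$ as a word over the alphabet $\{0,1,\#\}$ that lists, for each $i=1,\dots,m$, the number $C(v_i)$ in binary and the entries of the adjacency matrix of $G$ in row $i$ left of the diagonal, each of these two blocks being followed by $\#$. A language $L$ over a finite alphabet lies in NP if it has a polynomial-time verifier: a relation $R(x,y)$ between words $x$ and certificates $y$ (words over a finite alphabet) that a Turing machine decides in time polynomial in $|x|+|y|$, such that $R(x,y)$ implies $x\in L$, and such that every $x\in L$ has a certificate $y$ with $R(x,y)$ whose length is at most a fixed polynomial in $|x|$. Corollary 8. The cover solvability decision problem, which accepts a word if and only if it encodes a pair $(G,C)$ with $G$ a graph and $C$ a configuration that is cover solvable on $G$, is in NP. Moreover, vectors of move counts serve as the certificates: the following relation is a polynomial-time verifier for this problem. The word $x$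 encodes a pair $(G,C)$, and the word $y$ encodes (listing, for $i=1,\dots,m$ and $j=1,\dots,i-1$, the numbers $n_{ij}$ and $n_{ji}$ in binary, each followed by $\#$) integers $n_{ij}\ge 0$, $1\le i,j\le m$, with $n_{ij}=n_{ji}=0$ whenever $\{v_i,v_j\}\notin E(G)$ (in particular $n_{ii}=0$), such that for all $1\le k\le m$ $$C(v_k)+\sum_{l=1}^m n_{lk}-2\sum_{l=1}^m n_{kl}\ \ge\ 1 .$$ -/

import Mathlib

/-! ### Cover pebbling -/

/-- A pebbling move on `G`: two pebbles are removed from a vertex `u` carrying at least two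
pebbles, and one pebble is placed on a vertex `v` adjacent to `u`. -/
def PebblingMove {V : Type*} [DecidableEq V] (G : SimpleGraph V) (C D : V → ℕ) : Prop :=
  ∃ u v : V, G.Adj u v ∧ 2 ≤ C u ∧
    D = fun w => if w = u then C w - 2 else if w = v then C w + 1 else C w

/-- `C` is cover solvable on `G`: some finite sequence of pebbling moves leads from `C` to a
configuration with at least one pebble on every vertex simultaneously. -/
def CoverSolvable {V : Type*} [DecidableEq V] (G : SimpleGraph V) (C : V → ℕ) : Prop :=
  ∃ D : V → ℕ, Relation.ReflTransGen (PebblingMove G) C D ∧ ∀ v, 1 ≤ D v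

/-- `n i j` (the number of moves from `i` to `j`) is a vector of move counts for `(G, C)`:
it vanishes off the edges of `G`, and every vertex has a balance of at least one pebble. -/
def IsMoveCount {m : ℕ} (G : SimpleGraph (Fin m)) (C : Fin m → ℕ)
    (n : Fin m → Fin m → ℕ) : Prop :=
  (∀ i j, ¬ G.Adj i j → n i j = 0) ∧
  ∀ k, 1 ≤ (C k : ℤ) + ∑ l, (n l k : ℤ) - 2 * ∑ l, (n k l : ℤ)

/-! ### The class NP -/

/-- The pair of words `(x, y)` as one word `x # y`, the separator `#` being `none`. -/
def encodePair {Γ Δ : Type} (w : List Γ × List Δ) : List (Option (Γ ⊕ Δ)) :=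
  w.1.map (fun a => some (Sum.inl a)) ++ none :: w.2.map (fun b => some (Sum.inr b))

/-- A binary relation between words is decidable in polynomial time if its characteristic
function is computed by a Turing machine in time polynomial in the length of `x # y`. -/
def PolyTimeDecidable {Γ Δ : Type} (R : List Γ → List Δ → Prop) : Prop :=
  ∃ f : List Γ × List Δ → Bool, (∀ x y, f (x, y) = true ↔ R x y) ∧
    Nonempty (Turing.TM2ComputableInPolyTime encodePair Computability.encodeBool f)

/-- `R` is a polynomial-time verifier for `L`: `R` is decidable in polynomial time, only words of
`L` have certificates, and each word of `L` has a certificate of polynomially bounded length. -/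
def IsPolyVerifier {Γ Δ : Type} (R : List Γ → List Δ → Prop) (L : Language Γ) : Prop :=
  PolyTimeDecidable R ∧
  (∀ x y, R x y → x ∈ L) ∧
  ∃ p : Polynomial ℕ, ∀ x ∈ L, ∃ y, y.length ≤ p.eval x.length ∧ R x y

/-- The class NP of languages over the finite alphabet `Γ`. -/
def NP (Γ : Type) [Finite Γ] : Set (Language Γ) :=
  {L | ∃ (Δ : Type) (_ : Finite Δ) (R : List Γ → List Δ → Prop), IsPolyVerifier R L}

/-! ### Encodings, over the alphabet of the two bits and a separator -/

/-- The binary digits of a natural number, followed by the separator. -/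
def encodeNumber (a : ℕ) : List (Option Bool) :=
  a.bits.map some ++ [none]

/-- The vertices before `i`, in increasing order. -/
def verticesBelow {m : ℕ} (i : Fin m) : List (Fin m) :=
  (List.finRange m).filter (fun j => j < i)

open Classical in
/-- The encoding of a graph with a configuration: for each vertex `i` in turn, the number of
pebbles on `i` in binary, and the row of the adjacency matrix of `G` at `i` below the diagonal. -/
noncomputable def encodeInstance {m : ℕ} (G : SimpleGraph (Fin m)) (C : Fin m → ℕ) :
    List (Option Bool) :=
  (List.finRange m).flatMap fun i =>
    encodeNumber (C i) ++ (verticesBelow i).map (fun j => some (decide (G.Adj i j))) ++ [none]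

/-- The encoding of a vector of move counts: for each pair of vertices `j < i` in turn, the
numbers `n i j` and `n j i` in binary. The diagonal, where move counts vanish, is left out. -/
def encodeMoves {m : ℕ} (n : Fin m → Fin m → ℕ) : List (Option Bool) :=
  (List.finRange m).flatMap fun i =>
    (verticesBelow i).flatMap fun j => encodeNumber (n i j) ++ encodeNumber (n j i)

/-- The cover solvability problem: the words that encode a graph together with a configuration
that is cover solvable on it. -/
def coverSolvability : Language (Option Bool) :=
  {x | ∃ (m : ℕ) (G : SimpleGraph (Fin m)) (C : Fin m → ℕ),
    x = encodeInstance G C ∧ CoverSolvable G C}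

/-- `x` encodes a graph with a configuration, and `y` a vector of move counts for them. -/
def MoveCountCertificate (x y : List (Option Bool)) : Prop :=
  ∃ (m : ℕ) (G : SimpleGraph (Fin m)) (C : Fin m → ℕ) (n : Fin m → Fin m → ℕ),
    x = encodeInstance G C ∧ y = encodeMoves n ∧ IsMoveCount G C n

/-!
The balance of a vertex, with respect to move counts `n`, does not change if a move is performed and
removed from `n`. So the moves of a solution, counted, have positive balances. Conversely, suppose
that all balances are positive and `n ≠ 0`. If every vertex with an outgoing move carried at most
one pebble, each vertex would have at least twice as many incoming as outgoing moves, and summation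
over the vertices would give `n = 0`. So some move in `n` can be performed now, and induction on the
number of moves shows that the configuration is cover solvable.

Summing the balances bounds the number of moves by the number of pebbles, so certificates are short.
The verifier reads both words vertex by vertex and keeps the balances of the vertices read so far.
It stores them in the digits `-1, 0, 1`: then `p + u - 2 * v` is computed in one pass, carries are
bounded, and every update lengthens a balance by at most four digits.
-/

/-! ### Move counts and cover solvability -/

theorem pebblingMove_iff {V : Type*} [DecidableEq V] {G : SimpleGraph V} {C D : V → ℕ} :
    PebblingMove G C D ↔
      ∃ u v, G.Adj u v ∧ D + Pi.single u 2 = C + Pi.single v 1 := by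
  refine exists₂_congr fun u v => and_congr_right fun huv => ?_
  constructor
  · rintro ⟨hu, rfl⟩
    ext w
    rcases eq_or_ne w u with rfl | hwu
    · simp [huv.ne, hu]
    · rcases eq_or_ne w v with rfl | hwv <;> simp [*]
  · intro h
    have hD (w : V) : D w + (Pi.single u 2 : V → ℕ) w = C w + (Pi.single v 1 : V → ℕ) w :=
      congrFun h w
    have hDu := hD u
    simp only [Pi.single_eq_same, Pi.single_eq_of_ne huv.ne] at hDu
    refine ⟨by omega, funext fun w => ?_⟩
    have hDw := hD w
    simp only [Pi.single_apply] at hDw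
    split_ifs at hDw ⊢ <;> grind

section MoveCounts

variable {m : ℕ} {G : SimpleGraph (Fin m)} {C D : Fin m → ℕ} {n : Fin m → Fin m → ℕ}

theorem isMoveCount_iff_nat :
    IsMoveCount G C n ↔
      (∀ i j, ¬ G.Adj i j → n i j = 0) ∧ ∀ k, 1 + 2 * ∑ l, n k l ≤ C k + ∑ l, n l k := by
  refine and_congr_right fun _ => forall_congr' fun k => ?_
  rw [← Nat.cast_sum, ← Nat.cast_sum]
  omega

theorem IsMoveCount.sum_sum_le (h : IsMoveCount G C n) : ∑ i, ∑ j, n i j ≤ ∑ k, C k := by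
  have hsum := Finset.sum_le_sum fun k (_ : k ∈ Finset.univ) => (isMoveCount_iff_nat.1 h).2 k
  simp only [Finset.sum_add_distrib, ← Finset.mul_sum] at hsum
  rw [Finset.sum_comm (f := fun k l => n l k)] at hsum
  omega

theorem pi_single_le_iff {ι : Type*} {M : ι → Type*} [DecidableEq ι] [∀ i, AddCommMonoid (M i)]
    [∀ i, PartialOrder (M i)] [∀ i, CanonicallyOrderedAdd (M i)] {i : ι} {a : M i} {f : ∀ i, M i} :
    Pi.single i a ≤ f ↔ a ≤ f i := by
  simp [Pi.single, update_le_iff]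

theorem isMoveCount_add_single_iff {u v : Fin m} (huv : G.Adj u v)
    (hD : D + Pi.single u 2 = C + Pi.single v 1) :
    IsMoveCount G C (n + Pi.single u (Pi.single v 1)) ↔ IsMoveCount G D n := by
  have hrow (k : Fin m) : ∑ l, (Pi.single u (Pi.single v 1) : Fin m → Fin m → ℕ) k l =
      if k = u then 1 else 0 := by
    simp [Pi.single_apply, ite_apply]
  have hcol (k : Fin m) : ∑ l, (Pi.single u (Pi.single v 1) : Fin m → Fin m → ℕ) l k =
      if k = v then 1 else 0 := by
    simp [Pi.single_apply, ite_apply]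
  simp only [isMoveCount_iff_nat, Pi.add_apply, Finset.sum_add_distrib, hrow, hcol]
  refine and_congr (forall₂_congr fun i j => imp_congr_right fun hij => ?_)
    (forall_congr' fun k => ?_)
  · have h : ¬ (i = u ∧ j = v) := by rintro ⟨rfl, rfl⟩; exact hij huv
    rcases eq_or_ne i u with rfl | hi
    · simp [show j ≠ v from fun hj => h ⟨rfl, hj⟩]
    · simp [hi]
  · have hDk : D k + (Pi.single u 2 : Fin m → ℕ) k = C k + (Pi.single v 1 : Fin m → ℕ) k :=
      congrFun hD k
    simp only [Pi.single_apply] at hDk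
    split_ifs at hDk ⊢ <;> omega

theorem IsMoveCount.exists_available_move (h : IsMoveCount G C n) (hn : n ≠ 0) :
    ∃ u v, n u v ≠ 0 ∧ 2 ≤ C u := by
  by_contra! hC
  have hle (k : Fin m) : 2 * ∑ l, n k l ≤ ∑ l, n l k := by
    by_cases hk : ∃ l, n k l ≠ 0
    · obtain ⟨l, hl⟩ := hk
      have := hC k l hl
      have := (isMoveCount_iff_nat.1 h).2 k
      omega
    · push Not at hk
      simp [hk]
  have hsum : 2 * ∑ k, ∑ l, n k l ≤ ∑ k, ∑ l, n k l := by
    rw [Finset.mul_sum]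
    exact (Finset.sum_le_sum fun k _ => hle k).trans_eq Finset.sum_comm
  have hzero : ∑ k, ∑ l, n k l = 0 := by omega
  refine hn (funext₂ fun i j => ?_)
  simp only [Finset.sum_eq_zero_iff, Finset.mem_univ, true_imp_iff] at hzero
  exact hzero i j

theorem IsMoveCount.coverSolvable (h : IsMoveCount G C n) : CoverSolvable G C := by
  induction hN : ∑ i, ∑ j, n i j using Nat.strong_induction_on generalizing C n with
  | _ N ih =>
    by_cases hn : n = 0
    · exact ⟨C, .refl, fun k => by simpa [hn] using (isMoveCount_iff_nat.1 h).2 k⟩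
    obtain ⟨u, v, hnuv, hCu⟩ := h.exists_available_move hn
    have huv : G.Adj u v := not_imp_comm.1 ((isMoveCount_iff_nat.1 h).1 u v) hnuv
    obtain ⟨D, hD⟩ : ∃ D, D + Pi.single u 2 = C + Pi.single v 1 :=
      ⟨C + Pi.single v 1 - Pi.single u 2, tsub_add_cancel_of_le <|
        le_add_right <| pi_single_le_iff.2 hCu⟩
    obtain ⟨n', rfl⟩ : ∃ n', n = n' + Pi.single u (Pi.single v (1 : ℕ)) :=
      ⟨n - Pi.single u (Pi.single v 1), (tsub_add_cancel_of_le <|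
        pi_single_le_iff.2 <| pi_single_le_iff.2 <| Nat.one_le_iff_ne_zero.2 hnuv).symm⟩
    have hlt : ∑ i, ∑ j, n' i j < N := by
      simp [← hN, Finset.sum_add_distrib, Pi.single_apply, ite_apply]
    obtain ⟨E, hDE, hE⟩ := ih _ hlt ((isMoveCount_add_single_iff huv hD).1 h) rfl
    exact ⟨E, .head (pebblingMove_iff.2 ⟨u, v, huv, hD⟩) hDE, hE⟩

theorem CoverSolvable.exists_isMoveCount (h : CoverSolvable G C) : ∃ n, IsMoveCount G C n := by
  obtain ⟨E, hCE, hE⟩ := h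
  induction hCE using Relation.ReflTransGen.head_induction_on with
  | refl => exact ⟨0, isMoveCount_iff_nat.2 ⟨by simp, by simpa using hE⟩⟩
  | head hmove _ ih =>
    obtain ⟨n, hn⟩ := ih
    obtain ⟨u, v, huv, hD⟩ := pebblingMove_iff.1 hmove
    exact ⟨_, (isMoveCount_add_single_iff huv hD).2 hn⟩

end MoveCounts

/-! ### The length of certificates -/

theorem verticesBelow_eq_take {m : ℕ} (i : Fin m) :
    verticesBelow i = (List.finRange m).take i := by
  rw [verticesBelow, ← List.take_append_drop i (List.finRange m), List.filter_append,
    List.filter_eq_self.2, List.filter_eq_nil_iff.2]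
  · simp
  · intro j hj
    obtain ⟨k, hk, rfl⟩ := List.mem_drop_iff_getElem.1 hj
    simp [Fin.lt_def]
  · intro j hj
    obtain ⟨k, hk, rfl⟩ := List.mem_take_iff_getElem.1 hj
    simp only [List.getElem_finRange, Fin.lt_def, decide_eq_true_eq]
    exact hk.trans_le (min_le_left _ _)

theorem length_verticesBelow {m : ℕ} (i : Fin m) : (verticesBelow i).length = i := by
  simp [verticesBelow_eq_take]

theorem size_add_le (a b : ℕ) : (a + b).size ≤ a.size + b.size := by
  rw [Nat.size_le, pow_add]
  calc a + b < (a + 1) * (b + 1) := by nlinarith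
    _ ≤ 2 ^ a.size * 2 ^ b.size := Nat.mul_le_mul (Nat.lt_size_self a) (Nat.lt_size_self b)

theorem size_sum_le {ι : Type*} (s : Finset ι) (f : ι → ℕ) :
    (∑ i ∈ s, f i).size ≤ ∑ i ∈ s, (f i).size :=
  Finset.le_sum_of_subadditive Nat.size Nat.size_zero.le size_add_le s f

theorem length_flatMap_le {α β : Type*} {l : List α} {f : α → List β} {b : ℕ}
    (h : ∀ a ∈ l, (f a).length ≤ b) : (l.flatMap f).length ≤ l.length * b := by
  rw [List.length_flatMap, ← List.length_map (f := fun a => (f a).length)]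
  exact List.sum_le_card_nsmul _ b (by simpa using h)

theorem length_encodeNumber (a : ℕ) : (encodeNumber a).length = a.size + 1 := by
  simp [encodeNumber, Nat.size_eq_bits_len]

theorem length_encodeInstance {m : ℕ} (G : SimpleGraph (Fin m)) (C : Fin m → ℕ) :
    (encodeInstance G C).length = ∑ i, ((C i).size + 1 + (i + 1)) := by
  simp [encodeInstance, List.length_flatMap, length_encodeNumber, length_verticesBelow,
    Fin.sum_univ_def, add_assoc]

theorem card_le_length_encodeInstance {m : ℕ} (G : SimpleGraph (Fin m)) (C : Fin m → ℕ) :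
    m ≤ (encodeInstance G C).length := by
  rw [length_encodeInstance]
  calc m = ∑ _i : Fin m, 1 := by simp
    _ ≤ _ := Finset.sum_le_sum fun i _ => by omega

theorem size_sum_le_length_encodeInstance {m : ℕ} (G : SimpleGraph (Fin m)) (C : Fin m → ℕ) :
    (∑ k, C k).size ≤ (encodeInstance G C).length := by
  rw [length_encodeInstance]
  exact (size_sum_le _ C).trans (Finset.sum_le_sum fun i _ => by omega)

theorem length_encodeMoves_le_of_size_le {m s : ℕ} {n : Fin m → Fin m → ℕ}
    (h : ∀ i j, (n i j).size ≤ s) :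
    (encodeMoves n).length ≤ m * (m * (2 * (s + 1))) := by
  have hrow (i : Fin m) : ((verticesBelow i).flatMap fun j =>
      encodeNumber (n i j) ++ encodeNumber (n j i)).length ≤ m * (2 * (s + 1)) := by
    refine (length_flatMap_le (b := 2 * (s + 1)) fun j _ => ?_).trans ?_
    · simp only [List.length_append, length_encodeNumber]
      linarith [h i j, h j i]
    · rw [length_verticesBelow]
      gcongr
      exact i.is_lt.le
  exact (length_flatMap_le fun i _ => hrow i).trans_eq (by rw [List.length_finRange])

theorem IsMoveCount.length_encodeMoves_le {m : ℕ} {G : SimpleGraph (Fin m)} {C : Fin m → ℕ}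
    {n : Fin m → Fin m → ℕ} (h : IsMoveCount G C n) :
    (encodeMoves n).length ≤ (encodeInstance G C).length *
      ((encodeInstance G C).length * (2 * ((encodeInstance G C).length + 1))) := by
  have hn (i j : Fin m) : n i j ≤ ∑ k, C k :=
    calc n i j ≤ ∑ l, n i l := Finset.single_le_sum_of_canonicallyOrdered (Finset.mem_univ j)
      _ ≤ ∑ k, ∑ l, n k l := Finset.single_le_sum_of_canonicallyOrdered
        (f := fun k => ∑ l, n k l) (Finset.mem_univ i)
      _ ≤ ∑ k, C k := h.sum_sum_le
  have hm := card_le_length_encodeInstance G C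
  refine (length_encodeMoves_le_of_size_le fun i j => (Nat.size_le_size (hn i j)).trans
    (size_sum_le_length_encodeInstance G C)).trans ?_
  gcongr

/-! ### Reading numbers from words -/

section Blocks

variable {α : Type*}

/-- The letters of a word before its first separator. -/
def block : List (Option α) → List α
  | some a :: l => a :: block l
  | _ => []

/-- What remains of a word after its block. It is empty or begins with a separator. -/
def afterBlock : List (Option α) → List (Option α)
  | some _ :: l => afterBlock l
  | l => l

theorem map_some_block_append_afterBlock (l : List (Option α)) :
    (block l).map some ++ afterBlock l = l := by
  induction l with
  | nil => rfl
  | cons a l ih => cases a <;> simp [block, afterBlock, ih]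

theorem length_block_add_length_afterBlock (l : List (Option α)) :
    (block l).length + (afterBlock l).length = l.length := by
  simpa using congrArg List.length (map_some_block_append_afterBlock l)

theorem length_block_le (l : List (Option α)) : (block l).length ≤ l.length :=
  (Nat.le_add_right ..).trans_eq (length_block_add_length_afterBlock l)

theorem any_isSome_head?_afterBlock (l : List (Option α)) :
    (afterBlock l).head?.any Option.isSome = false := by
  induction l with
  | nil => rfl
  | cons a l ih => cases a <;> simp [afterBlock, ih]

theorem block_map_some_append (b : List α) (l : List (Option α)) :
    block (b.map some ++ none :: l) = b := by
  induction b <;> simp [block, *]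

theorem afterBlock_map_some_append (b : List α) (l : List (Option α)) :
    afterBlock (b.map some ++ none :: l) = none :: l := by
  induction b <;> simp [afterBlock, *]

end Blocks

/-- The natural number with the given binary digits, the least significant one first. -/
def ofBits (l : List Bool) : ℕ :=
  l.foldr Nat.bit 0

theorem ofBits_bits (a : ℕ) : ofBits a.bits = a := by
  induction a using Nat.binaryRec' with
  | zero => simp [ofBits]
  | bit b n hn ih => rw [Nat.bits_append_bit n b hn, ofBits, List.foldr_cons, ← ofBits, ih]

theorem getLast?_bits_ne (a : ℕ) : a.bits.getLast? ≠ some false := by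
  induction a using Nat.binaryRec' with
  | zero => simp
  | bit b n hn ih =>
    rw [Nat.bits_append_bit n b hn, List.getLast?_cons]
    rcases h : n.bits.getLast? with _ | c
    · have hn0 : n = 0 := by rw [← ofBits_bits n, List.getLast?_eq_none_iff.1 h, ofBits]; rfl
      simp [hn hn0]
    · simpa [h] using ih

theorem bits_ofBits {l : List Bool} (h : l.getLast? ≠ some false) : (ofBits l).bits = l := by
  induction l with
  | nil => simp [ofBits]
  | cons b l ih =>
    have hl : l.getLast? ≠ some false := by
      intro hl
      simp [List.getLast?_cons, hl] at h
    rw [ofBits, List.foldr_cons, ← ofBits, Nat.bits_append_bit, ih hl]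
    intro h0
    have : l = [] := by rw [← ih hl, h0, Nat.zero_bits]
    simpa [this] using h

/-- The number at the beginning of a word. -/
def number (w : List (Option Bool)) : ℕ :=
  ofBits (block w)

/-- What remains of a word after the number at its beginning. -/
def afterNumber (w : List (Option Bool)) : List (Option Bool) :=
  (afterBlock w).tail

theorem length_afterNumber_le (w : List (Option Bool)) : (afterNumber w).length ≤ w.length := by
  have := length_block_add_length_afterBlock w
  rw [afterNumber, List.length_tail]
  omega

theorem length_afterNumber_lt {w : List (Option Bool)} (hw : w ≠ []) :
    (afterNumber w).length < w.length := by
  have := length_block_add_length_afterBlock w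
  have := List.length_pos_iff.2 hw
  rw [afterNumber, List.length_tail]
  omega

/-- Whether a word begins with the encoding of a number, which has to be `0` unless `edge`. -/
def numberOk (edge : Bool) (w : List (Option Bool)) : Bool :=
  (afterBlock w).head? == some none && (block w).getLast? != some false &&
    (edge || (block w).isEmpty)

section EncodeNumber

variable (a : ℕ) (w : List (Option Bool))

theorem number_encodeNumber_append : number (encodeNumber a ++ w) = a := by
  simp [number, encodeNumber, block_map_some_append, ofBits_bits]

theorem afterNumber_encodeNumber_append : afterNumber (encodeNumber a ++ w) = w := by
  simp [afterNumber, encodeNumber, afterBlock_map_some_append]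

theorem numberOk_encodeNumber_append (edge : Bool) :
    numberOk edge (encodeNumber a ++ w) = (edge || a == 0) := by
  have ha : a.bits.isEmpty = (a == 0) := by
    rw [Bool.eq_iff_iff, List.isEmpty_iff, beq_iff_eq]
    exact ⟨fun h => by rw [← ofBits_bits a, h]; rfl, fun h => by rw [h, Nat.zero_bits]⟩
  simp [numberOk, encodeNumber, block_map_some_append, afterBlock_map_some_append,
    getLast?_bits_ne, ha]

variable {w}

theorem encodeNumber_number_append {edge : Bool} (h : numberOk edge w = true) :
    encodeNumber (number w) ++ afterNumber w = w := by
  simp only [numberOk, Bool.and_eq_true, beq_iff_eq, bne_iff_ne] at h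
  obtain ⟨rest, hrest⟩ := (List.head?_eq_some_iff.1 h.1.1)
  rw [number, afterNumber, encodeNumber, bits_ofBits h.1.2, hrest, List.tail_cons,
    List.append_assoc, List.singleton_append, ← hrest, map_some_block_append_afterBlock]

end EncodeNumber

/-! ### The verifier as a function on words -/

/-- What the encodings record for a pair of vertices `j < i`: whether they are adjacent, and the
numbers of moves from `i` to `j` and from `j` to `i`. -/
structure Entry where
  edge : Bool
  out : ℕ
  inc : ℕ

/-- Whether the move counts of an entry vanish unless the vertices are adjacent. -/
def Entry.valid (e : Entry) : Bool :=
  e.edge || e.out == 0 && e.inc == 0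

/-- The part of the encoding of an instance for one vertex, from its number of pebbles and its
entries. -/
def instanceRow (c : ℕ) (es : List Entry) : List (Option Bool) :=
  encodeNumber c ++ es.map (some ·.edge) ++ [none]

/-- The part of the encoding of move counts for one vertex, from its entries. -/
def movesRow (es : List Entry) : List (Option Bool) :=
  es.flatMap fun e => encodeNumber e.out ++ encodeNumber e.inc

/-- The progress of the verifier: the balances of the vertices that have been read (`accs`), that
of the vertex being read (`own`), the unread parts of the instance (`x`) and of the certificate
(`y`), and whether they have been well-formed so far. -/
structure Tally (α : Type) where
  accs : List α
  own : α
  x : List (Option Bool)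
  y : List (Option Bool)
  ok : Bool

namespace Tally

/-- Reads the entry for the vertex being read and an earlier vertex with balance `a`. -/
def entry (s : Tally ℤ) (a : ℤ) : Tally ℤ :=
  let edge := s.x.head?.join
  let out := number s.y
  let inc := number (afterNumber s.y)
  { accs := s.accs ++ [a + out - 2 * inc]
    own := s.own + inc - 2 * out
    x := s.x.tail
    y := afterNumber (afterNumber s.y)
    ok := s.ok && edge.isSome && numberOk (edge == some true) s.y &&
      numberOk (edge == some true) (afterNumber s.y) }

/-- Begins reading a vertex. -/
def startRow (s : Tally ℤ) : Tally ℤ where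
  accs := []
  own := number s.x
  x := afterNumber s.x
  y := s.y
  ok := s.ok && numberOk true s.x

/-- Finishes reading a vertex. -/
def endRow (s : Tally ℤ) : Tally ℤ where
  accs := s.accs ++ [s.own]
  own := 0
  x := s.x.tail
  y := s.y
  ok := s.ok && s.x.head? == some none

/-- Reads the part of the encodings for one vertex, if there is any. -/
def row (s : Tally ℤ) : Tally ℤ :=
  if s.x = [] then s else (s.accs.foldl entry s.startRow).endRow

end Tally

/-- The verifier as a function on words. -/
def verify (x y : List (Option Bool)) : Bool :=
  let s := Tally.row^[x.length] ⟨[], 0, x, y, true⟩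
  s.ok && s.y.isEmpty && s.accs.all (0 < ·)

namespace Tally

section Complete

variable {ι : Type*} (A : ι → ℤ) (E : ι → Entry) (x y : List (Option Bool))

theorem foldl_entry_map {js : List ι} (hE : ∀ j ∈ js, (E j).valid) (accs : List ℤ) (own : ℤ)
    (ok : Bool) :
    (js.map A).foldl entry ⟨accs, own, (js.map E).map (some ·.edge) ++ x,
        movesRow (js.map E) ++ y, ok⟩ =
      ⟨accs ++ js.map fun j => A j + (E j).out - 2 * (E j).inc,
        own + (js.map fun j => ((E j).inc - 2 * (E j).out : ℤ)).sum, x, y, ok⟩ := by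
  induction js generalizing accs own with
  | nil => simp [movesRow]
  | cons j js ih =>
    have hj : (E j).valid := hE j (by simp)
    have hentry : entry ⟨accs, own, ((j :: js).map E).map (some ·.edge) ++ x,
          movesRow ((j :: js).map E) ++ y, ok⟩ (A j) =
        ⟨accs ++ [A j + (E j).out - 2 * (E j).inc], own + (E j).inc - 2 * (E j).out,
          (js.map E).map (some ·.edge) ++ x, movesRow (js.map E) ++ y, ok⟩ := by
      have hok : (ok && ((E j).edge || (E j).out == 0) && ((E j).edge || (E j).inc == 0)) = ok := by
        rw [Bool.and_assoc, ← Bool.or_and_distrib_left]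
        exact (congrArg (ok && ·) hj).trans (Bool.and_true ok)
      simp [entry, movesRow, number_encodeNumber_append, afterNumber_encodeNumber_append,
        numberOk_encodeNumber_append, hok]
    rw [List.map_cons (f := A), List.foldl_cons, hentry, ih fun j' hj' => hE j' (by simp [hj'])]
    simp [add_assoc, add_sub_assoc]

theorem row_map {js : List ι} (hE : ∀ j ∈ js, (E j).valid) (own : ℤ) (c : ℕ) (ok : Bool) :
    row ⟨js.map A, own, instanceRow c (js.map E) ++ x, movesRow (js.map E) ++ y, ok⟩ =
      ⟨js.map (fun j => A j + (E j).out - 2 * (E j).inc) ++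
        [c + (js.map fun j => ((E j).inc - 2 * (E j).out : ℤ)).sum], 0, x, y, ok⟩ := by
  have hne : instanceRow c (js.map E) ++ x ≠ [] := by simp [instanceRow]
  have hstart : startRow ⟨js.map A, own, instanceRow c (js.map E) ++ x,
      movesRow (js.map E) ++ y, ok⟩ =
      ⟨[], c, (js.map E).map (some ·.edge) ++ none :: x, movesRow (js.map E) ++ y, ok⟩ := by
    simp [startRow, instanceRow, number_encodeNumber_append, afterNumber_encodeNumber_append,
      numberOk_encodeNumber_append]
  rw [row, if_neg hne, hstart, foldl_entry_map A E _ _ hE]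
  simp only [endRow, List.nil_append, List.tail_cons, List.head?_cons, beq_self_eq_true,
    Bool.and_true]

end Complete

section Sound

theorem of_entry_ok {s : Tally ℤ} {a : ℤ} (h : (s.entry a).ok) :
    s.ok ∧ ∃ e : Entry, e.valid ∧ s.x = some e.edge :: (s.entry a).x ∧
      s.y = encodeNumber e.out ++ (encodeNumber e.inc ++ (s.entry a).y) := by
  obtain ⟨accs, own, x, y, ok⟩ := s
  simp only [entry, Bool.and_eq_true] at h
  obtain ⟨⟨⟨hok, hsome⟩, hout⟩, hinc⟩ := h
  obtain ⟨b, x, rfl⟩ : ∃ b x', x = some b :: x' := by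
    rcases x with _ | ⟨_ | b, x⟩ <;> simp at hsome ⊢
  have hy := encodeNumber_number_append hout
  have hy' := encodeNumber_number_append hinc
  refine ⟨hok, ⟨b, number y, number (afterNumber y)⟩, ?_, rfl, ?_⟩
  · rw [← hy, numberOk_encodeNumber_append] at hout
    rw [← hy', numberOk_encodeNumber_append] at hinc
    cases b <;> simp_all [Entry.valid]
  · simp only [entry, hy', hy]

theorem of_foldl_entry_ok {as : List ℤ} {s : Tally ℤ} (h : (as.foldl entry s).ok) :
    s.ok ∧ ∃ es : List Entry, es.length = as.length ∧ (∀ e ∈ es, e.valid) ∧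
      s.x = es.map (some ·.edge) ++ (as.foldl entry s).x ∧
      s.y = movesRow es ++ (as.foldl entry s).y := by
  induction as generalizing s with
  | nil => exact ⟨h, [], rfl, by simp, rfl, rfl⟩
  | cons a as ih =>
    obtain ⟨hok, es, hlen, hes, hx, hy⟩ := ih h
    obtain ⟨hok, e, he, hx', hy'⟩ := of_entry_ok hok
    refine ⟨hok, e :: es, by simp [hlen], by simpa [he] using hes, ?_, ?_⟩
    · rw [hx', hx]; rfl
    · rw [hy', hy]; simp [movesRow]

theorem length_accs_foldl_entry (as : List ℤ) (s : Tally ℤ) :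
    (as.foldl entry s).accs.length = s.accs.length + as.length := by
  induction as generalizing s with
  | nil => rfl
  | cons a as ih =>
    rw [List.foldl_cons, ih, entry, List.length_append, List.length_singleton, List.length_cons]
    omega

theorem length_accs_row {s : Tally ℤ} (hx : s.x ≠ []) :
    s.row.accs.length = s.accs.length + 1 := by
  simp [row, hx, endRow, length_accs_foldl_entry, startRow]

theorem of_row_ok {s : Tally ℤ} (hx : s.x ≠ []) (h : s.row.ok) :
    s.ok ∧ ∃ (c : ℕ) (es : List Entry), es.length = s.accs.length ∧ (∀ e ∈ es, e.valid) ∧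
      s.x = instanceRow c es ++ s.row.x ∧ s.y = movesRow es ++ s.row.y := by
  rw [row, if_neg hx] at h ⊢
  simp only [endRow, Bool.and_eq_true, beq_iff_eq, List.head?_eq_some_iff] at h ⊢
  obtain ⟨hfold, rest, hrest⟩ := h
  obtain ⟨hok, es, hlen, hes, hx', hy'⟩ := of_foldl_entry_ok hfold
  have hx' : afterNumber s.x = _ := hx'
  simp only [startRow, Bool.and_eq_true] at hok
  refine ⟨hok.1, number s.x, es, hlen, hes, ?_, hy'⟩
  rw [hrest] at hx' ⊢
  rw [instanceRow, List.append_assoc, List.append_assoc, List.tail_cons, List.singleton_append,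
    ← hx', encodeNumber_number_append hok.2]

theorem of_iterate_row_ok {k : ℕ} {s : Tally ℤ} (h : (row^[k] s).ok) :
    s.ok ∧ ∃ rows : List (ℕ × List Entry),
      rows.map (·.2.length) = List.range' s.accs.length rows.length ∧
      (∀ r ∈ rows, ∀ e ∈ r.2, e.valid) ∧
      s.x = rows.flatMap (fun r => instanceRow r.1 r.2) ++ (row^[k] s).x ∧
      s.y = rows.flatMap (fun r => movesRow r.2) ++ (row^[k] s).y := by
  induction k generalizing s with
  | zero => exact ⟨h, [], rfl, by simp, rfl, rfl⟩
  | succ k ih =>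
    rw [Function.iterate_succ_apply] at h ⊢
    obtain ⟨hok, rows, hlen, hrows, hx', hy'⟩ := ih h
    by_cases hx : s.x = []
    · rw [row, if_pos hx] at hok hlen hx' hy' ⊢
      exact ⟨hok, rows, hlen, hrows, hx', hy'⟩
    obtain ⟨hok, c, es, hes_len, hes, hsx, hsy⟩ := of_row_ok hx hok
    refine ⟨hok, (c, es) :: rows, ?_, List.forall_mem_cons.2 ⟨hes, hrows⟩, ?_, ?_⟩
    · rw [length_accs_row hx] at hlen
      simp [hlen, hes_len, List.range'_succ]
    · rw [hsx, hx']; simp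
    · rw [hsy, hy']; simp

end Sound

theorem length_x_foldl_entry_le (as : List ℤ) (s : Tally ℤ) :
    (as.foldl entry s).x.length ≤ s.x.length := by
  induction as generalizing s with
  | nil => rfl
  | cons a as ih => exact (ih _).trans (by simp [entry])

theorem length_x_row_lt {s : Tally ℤ} (hx : s.x ≠ []) : s.row.x.length < s.x.length := by
  rw [row, if_neg hx]
  calc (s.accs.foldl entry s.startRow).x.tail.length
      ≤ (s.accs.foldl entry s.startRow).x.length := by simp
    _ ≤ (afterNumber s.x).length := length_x_foldl_entry_le _ _
    _ < s.x.length := length_afterNumber_lt hx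

theorem x_iterate_row {k : ℕ} {s : Tally ℤ} (h : s.x.length ≤ k) : (row^[k] s).x = [] := by
  induction k generalizing s with
  | zero => simpa using h
  | succ k ih =>
    rw [Function.iterate_succ_apply]
    by_cases hx : s.x = []
    · exact ih (by simp [row, hx])
    · exact ih (by have := length_x_row_lt hx; omega)

end Tally

section Encode

variable {m : ℕ} (G : SimpleGraph (Fin m)) (C : Fin m → ℕ) (n : Fin m → Fin m → ℕ)

open Classical in
/-- The entry for the vertices `i` and `j`. -/
noncomputable def graphEntry (i j : Fin m) : Entry :=
  ⟨decide (G.Adj i j), n i j, n j i⟩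

theorem encodeInstance_eq_flatMap : encodeInstance G C = (List.finRange m).flatMap fun i =>
    instanceRow (C i) ((verticesBelow i).map (graphEntry G n i)) := by
  simp [encodeInstance, instanceRow, graphEntry, Function.comp_def]

theorem encodeMoves_eq_flatMap : encodeMoves n = (List.finRange m).flatMap fun i =>
    movesRow ((verticesBelow i).map (graphEntry G n i)) := by
  simp [encodeMoves, movesRow, graphEntry, List.flatMap_map]

/-- The balance of the vertex `k` in which only the moves from and to the first `i` vertices
count. -/
def partialBalance (i : ℕ) (k : Fin m) : ℤ :=
  C k + (((List.finRange m).take i).map fun l => (n l k - 2 * n k l : ℤ)).sum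

theorem partialBalance_succ (i k : Fin m) :
    partialBalance C n (i + 1) k = partialBalance C n i k + n i k - 2 * n k i := by
  simp [partialBalance, List.take_add_one, add_assoc, add_sub_assoc]

theorem partialBalance_card (k : Fin m) :
    partialBalance C n m k = C k + ∑ l, (n l k : ℤ) - 2 * ∑ l, (n k l : ℤ) := by
  rw [partialBalance, List.take_of_length_le (by simp), ← Fin.sum_univ_def,
    Finset.sum_sub_distrib, ← Finset.mul_sum, add_sub_assoc]

variable {G n}

theorem row_encode (hn : ∀ i j, ¬ G.Adj i j → n i j = 0) (i : Fin m) (x y : List (Option Bool))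
    (ok : Bool) :
    Tally.row ⟨((List.finRange m).take i).map (partialBalance C n i), 0,
        instanceRow (C i) ((verticesBelow i).map (graphEntry G n i)) ++ x,
        movesRow ((verticesBelow i).map (graphEntry G n i)) ++ y, ok⟩ =
      ⟨((List.finRange m).take (i + 1)).map (partialBalance C n (i + 1)), 0, x, y, ok⟩ := by
  have hvalid (j : Fin m) : (graphEntry G n i j).valid := by
    by_cases hij : G.Adj i j
    · simp [graphEntry, Entry.valid, hij]
    · simp [graphEntry, Entry.valid, hn i j hij, hn j i (mt G.adj_symm hij)]
  rw [verticesBelow_eq_take, Tally.row_map _ _ _ _ fun j _ => hvalid j]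
  have hii : n i i = 0 := hn i i (G.loopless.irrefl i)
  have hsucc : partialBalance C n (i + 1) =
      fun j => partialBalance C n i j + (graphEntry G n i j).out - 2 * (graphEntry G n i j).inc :=
    funext (partialBalance_succ C n i)
  have hself : partialBalance C n (i + 1) i =
      C i + (((List.finRange m).take i).map fun j =>
        ((graphEntry G n i j).inc - 2 * (graphEntry G n i j).out : ℤ)).sum := by
    rw [partialBalance_succ, hii]
    simp [partialBalance, graphEntry]
  rw [List.take_add_one, List.map_append, ← hsucc, ← hself]
  simp

theorem iterate_row_encode (hn : ∀ i j, ¬ G.Adj i j → n i j = 0) {i : ℕ} (hi : i ≤ m) :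
    Tally.row^[i] ⟨[], 0, encodeInstance G C, encodeMoves n, true⟩ =
      ⟨((List.finRange m).take i).map (partialBalance C n i), 0,
        ((List.finRange m).drop i).flatMap fun i =>
          instanceRow (C i) ((verticesBelow i).map (graphEntry G n i)),
        ((List.finRange m).drop i).flatMap fun i =>
          movesRow ((verticesBelow i).map (graphEntry G n i)), true⟩ := by
  induction i with
  | zero => simp [encodeInstance_eq_flatMap G C n, encodeMoves_eq_flatMap G n]
  | succ i ih =>
    have hdrop : (List.finRange m).drop i = ⟨i, hi⟩ :: (List.finRange m).drop (i + 1) := by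
      rw [List.drop_eq_getElem_cons (by simpa using hi), List.getElem_finRange]
      rfl
    rw [Function.iterate_succ_apply', ih (by omega), hdrop, List.flatMap_cons, List.flatMap_cons]
    exact row_encode C hn ⟨i, hi⟩ _ _ true

theorem verify_encode (hn : ∀ i j, ¬ G.Adj i j → n i j = 0) :
    verify (encodeInstance G C) (encodeMoves n) = true ↔ IsMoveCount G C n := by
  obtain ⟨k, hk⟩ := Nat.exists_eq_add_of_le' (card_le_length_encodeInstance G C)
  have hlast : Tally.row^[k + m] ⟨[], 0, encodeInstance G C, encodeMoves n, true⟩ =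
      ⟨(List.finRange m).map (partialBalance C n m), 0, [], [], true⟩ := by
    rw [Function.iterate_add_apply, iterate_row_encode C hn le_rfl,
      List.take_of_length_le (by simp), List.drop_of_length_le (by simp)]
    exact Function.iterate_fixed rfl k
  rw [verify, hk, hlast, IsMoveCount, and_iff_right hn]
  simp [Int.lt_iff_add_one_le, partialBalance_card]

end Encode

theorem exists_encode_eq {rows : List (ℕ × List Entry)}
    (hlen : rows.map (·.2.length) = List.range rows.length)
    (hrows : ∀ r ∈ rows, ∀ e ∈ r.2, e.valid) :
    ∃ (m : ℕ) (G : SimpleGraph (Fin m)) (C : Fin m → ℕ) (n : Fin m → Fin m → ℕ),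
      (∀ i j, ¬ G.Adj i j → n i j = 0) ∧
      encodeInstance G C = rows.flatMap (fun r => instanceRow r.1 r.2) ∧
      encodeMoves n = rows.flatMap fun r => movesRow r.2 := by
  have hlen' (i : Fin rows.length) : rows[i].2.length = i := by
    simpa using congrArg (·[i]?) hlen
  let entry (i j : Fin rows.length) (h : j < i) : Entry := rows[i].2[j]'(by rw [hlen']; exact h)
  have hvalid {i j} (h : j < i) (hedge : ¬ (entry i j h).edge) :
      (entry i j h).out = 0 ∧ (entry i j h).inc = 0 := by
    have := hrows _ (List.getElem_mem _) (entry i j h) (List.getElem_mem _)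
    simpa [Entry.valid, hedge] using this
  let G := SimpleGraph.fromRel fun i j => ∃ h : j < i, (entry i j h).edge
  let n (i j : Fin rows.length) : ℕ :=
    if h : j < i then (entry i j h).out else if h : i < j then (entry j i h).inc else 0
  have hadj {i j} (h : j < i) : G.Adj i j ↔ (entry i j h).edge := by
    simp [G, h, h.ne', h.not_gt]
  have hrow (i : Fin rows.length) : (verticesBelow i).map (graphEntry G n i) = rows[i].2 := by
    refine List.ext_getElem (by rw [List.length_map, length_verticesBelow, hlen']) fun j h₁ h₂ => ?_
    let k : Fin rows.length := ⟨j, (h₂.trans_eq (hlen' i)).trans i.2⟩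
    have hk : k < i := h₂.trans_eq (hlen' i)
    have hget : (verticesBelow i)[j]'(by rwa [List.length_map] at h₁) = k := by
      simp [verticesBelow_eq_take, k]
    have hout : n i k = (entry i k hk).out := dif_pos hk
    have hinc : n k i = (entry i k hk).inc := (dif_neg hk.not_gt).trans (dif_pos hk)
    simp only [List.getElem_map, hget, graphEntry, hadj hk, hout, hinc, Bool.decide_eq_true]
    rfl
  refine ⟨rows.length, G, fun i => rows[i].1, n, fun i j hij => ?_, ?_, ?_⟩
  · rcases lt_trichotomy j i with h | rfl | h
    · simp [n, h, hvalid h (mt (hadj h).2 hij)]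
    · simp [n]
    · simp [n, h, h.not_gt, hvalid h (mt (hadj h).2 (mt G.adj_symm hij))]
  · rw [encodeInstance_eq_flatMap G _ n]
    simp only [hrow]
    conv_rhs => rw [← List.map_getElem_finRange rows, List.flatMap_map]
    rfl
  · rw [encodeMoves_eq_flatMap G]
    simp only [hrow]
    conv_rhs => rw [← List.map_getElem_finRange rows, List.flatMap_map]
    rfl

theorem verify_iff (x y : List (Option Bool)) :
    verify x y = true ↔ MoveCountCertificate x y := by
  constructor
  · intro h
    have h' := h
    simp only [verify, Bool.and_eq_true, List.isEmpty_iff] at h'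
    obtain ⟨⟨hok, hy⟩, -⟩ := h'
    obtain ⟨-, rows, hlen, hrows, hx', hy'⟩ := Tally.of_iterate_row_ok hok
    rw [List.length_nil, ← List.range_eq_range'] at hlen
    obtain ⟨m, G, C, n, hn, hC, hm⟩ := exists_encode_eq hlen hrows
    rw [Tally.x_iterate_row (s := ⟨[], 0, x, y, true⟩) le_rfl, List.append_nil, ← hC] at hx'
    rw [hy, List.append_nil, ← hm] at hy'
    obtain rfl : x = _ := hx'
    obtain rfl : y = _ := hy'
    exact ⟨m, G, C, n, rfl, rfl, (verify_encode C hn).1 h⟩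
  · rintro ⟨m, G, C, n, rfl, rfl, hn⟩
    exact (verify_encode C hn.1).2 hn

/-! ### Structured programs for stack machines -/

namespace StackProgram

open Turing StateTransition

variable {K : Type} {Γ : K → Type} {σ : Type}

/-- A single action on finitely many stacks and a register of type `σ`. -/
inductive Act (Γ : K → Type) (σ : Type)
  | push (k : K) (f : σ → Γ k)
  | peek (k : K) (f : σ → Option (Γ k) → σ)
  | pop (k : K) (f : σ → Option (Γ k) → σ)
  | load (f : σ → σ)

/-- A state consists of the register and the stacks. -/
abbrev State (Γ : K → Type) (σ : Type) := σ × ∀ k, List (Γ k)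

/-- Prepending an action to a statement of the stack machine. -/
def Act.toStmt {Λ : Type} : Act Γ σ → TM2.Stmt Γ Λ σ → TM2.Stmt Γ Λ σ
  | push k f => TM2.Stmt.push k f
  | peek k f => TM2.Stmt.peek k f
  | pop k f => TM2.Stmt.pop k f
  | load f => TM2.Stmt.load f

/-- Structured programs: blocks of actions, sequential composition, and loops. A loop tests in
the middle of each round: `loop p b q` runs `p`, and as long as `b` holds then, `q` and `p`. -/
inductive Prog (Γ : K → Type) (σ : Type)
  | block (l : List (Act Γ σ))
  | seq (p q : Prog Γ σ)
  | loop (p : Prog Γ σ) (b : σ → Bool) (q : Prog Γ σ)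

infixr:67 " ⨾ " => Prog.seq

namespace Prog

/-- The program points, which label the statements of the compiled program. -/
def Pos : Prog Γ σ → Type
  | block _ => Unit
  | p ⨾ q | loop p _ q => p.Pos ⊕ q.Pos

instance finite_pos : ∀ p : Prog Γ σ, Finite p.Pos
  | block _ => inferInstanceAs (Finite Unit)
  | p ⨾ q | loop p _ q =>
    have := finite_pos p
    have := finite_pos q
    inferInstanceAs (Finite (p.Pos ⊕ q.Pos))

/-- The program point at which a program starts. -/
def entry : (p : Prog Γ σ) → p.Pos
  | block _ => ()
  | p ⨾ _ | loop p _ _ => Sum.inl p.entry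

/-- The statement at each program point of `p`, where `e` embeds the program points of `p` into
all labels and `cont` is executed after `p`. -/
def code {Λ : Type} : (p : Prog Γ σ) → (p.Pos → Λ) → TM2.Stmt Γ Λ σ → p.Pos → TM2.Stmt Γ Λ σ
  | block l, _, cont, _ => l.foldr Act.toStmt cont
  | p ⨾ q, e, cont, a =>
    match a with
    | Sum.inl a => p.code (e ∘ Sum.inl) (TM2.Stmt.goto fun _ => e (Sum.inr q.entry)) a
    | Sum.inr a => q.code (e ∘ Sum.inr) cont a
  | loop p b q, e, cont, a =>
    match a with
    | Sum.inl a =>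
      p.code (e ∘ Sum.inl) (TM2.Stmt.branch b (TM2.Stmt.goto fun _ => e (Sum.inr q.entry)) cont) a
    | Sum.inr a => q.code (e ∘ Sum.inr) (TM2.Stmt.goto fun _ => e (Sum.inl p.entry)) a

end Prog

variable [DecidableEq K]

/-- The effect of an action. -/
def Act.run : State Γ σ → Act Γ σ → State Γ σ
  | s, push k f => (s.1, Function.update s.2 k (f s.1 :: s.2 k))
  | s, peek k f => (f s.1 (s.2 k).head?, s.2)
  | s, pop k f => (f s.1 (s.2 k).head?, Function.update s.2 k (s.2 k).tail)
  | s, load f => (f s.1, s.2)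

/-- `Runs p s s' t`: started in the state `s`, the program `p` ends in the state `s'` after at
most `t` steps of the compiled program. -/
inductive Runs : Prog Γ σ → State Γ σ → State Γ σ → ℕ → Prop
  | block (l : List (Act Γ σ)) (s : State Γ σ) : Runs (.block l) s (l.foldl Act.run s) 1
  | seq {p q : Prog Γ σ} {s s₁ s₂ : State Γ σ} {t₁ t₂ : ℕ} (hp : Runs p s s₁ t₁)
      (hq : Runs q s₁ s₂ t₂) : Runs (p ⨾ q) s s₂ (t₁ + t₂)
  | loop_exit {p : Prog Γ σ} {b : σ → Bool} {q : Prog Γ σ} {s s₁ : State Γ σ} {t : ℕ}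
      (hp : Runs p s s₁ t) (hb : b s₁.1 = false) : Runs (.loop p b q) s s₁ t
  | loop_step {p : Prog Γ σ} {b : σ → Bool} {q : Prog Γ σ} {s s₁ s₂ s₃ : State Γ σ}
      {t₁ t₂ t₃ : ℕ} (hp : Runs p s s₁ t₁) (hb : b s₁.1 = true) (hq : Runs q s₁ s₂ t₂)
      (hloop : Runs (.loop p b q) s₂ s₃ t₃) : Runs (.loop p b q) s s₃ (t₁ + t₂ + t₃)
  | mono {p : Prog Γ σ} {s s' : State Γ σ} {t t' : ℕ} (h : Runs p s s' t) (ht : t ≤ t') :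
      Runs p s s' t'

theorem stepAux_foldr_toStmt {Λ : Type} (l : List (Act Γ σ)) (cont : TM2.Stmt Γ Λ σ)
    (s : State Γ σ) :
    TM2.stepAux (l.foldr Act.toStmt cont) s.1 s.2 =
      TM2.stepAux cont (l.foldl Act.run s).1 (l.foldl Act.run s).2 := by
  induction l generalizing s with
  | nil => rfl
  | cons a l ih =>
    rw [List.foldl_cons, ← ih]
    cases a <;> rfl

theorem Runs.evalsToInTime {Λ : Type} {M : Λ → TM2.Stmt Γ Λ σ} {p : Prog Γ σ} {s s' : State Γ σ}
    {t : ℕ} (h : Runs p s s' t) (e : p.Pos → Λ) (cont : TM2.Stmt Γ Λ σ)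
    (hM : ∀ a, M (e a) = p.code e cont a) :
    Nonempty (EvalsToInTime (TM2.step M) ⟨some (e p.entry), s.1, s.2⟩
      (some (TM2.stepAux cont s'.1 s'.2)) t) := by
  induction h generalizing cont with
  | block l s =>
    refine ⟨⟨⟨1, ?_⟩, le_rfl⟩⟩
    rw [← stepAux_foldr_toStmt]
    exact congrArg (fun c => some (TM2.stepAux c s.1 s.2)) (hM ())
  | seq _ _ ihp ihq =>
    obtain ⟨hp⟩ := ihp (e ∘ Sum.inl) _ fun a => hM (Sum.inl a)
    obtain ⟨hq⟩ := ihq (e ∘ Sum.inr) cont fun a => hM (Sum.inr a)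
    rw [add_comm]
    exact ⟨hp.trans _ _ _ _ _ _ hq⟩
  | loop_exit _ hb ihp =>
    obtain ⟨hp⟩ := ihp (e ∘ Sum.inl) _ fun a => hM (Sum.inl a)
    rw [TM2.stepAux, hb] at hp
    exact ⟨hp⟩
  | @loop_step p b q s s₁ s₂ s₃ t₁ t₂ t₃ _ hb _ _ ihp ihq ihloop =>
    obtain ⟨hp⟩ := ihp (e ∘ Sum.inl) _ fun a => hM (Sum.inl a)
    rw [TM2.stepAux, hb] at hp
    obtain ⟨hq⟩ := ihq (e ∘ Sum.inr) _ fun a => hM (Sum.inr a)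
    obtain ⟨hloop⟩ := ihloop e cont hM
    rw [add_comm, add_comm t₁]
    exact ⟨.trans _ _ _ _ _ _ (.trans _ _ _ _ _ _ hp hq) hloop⟩
  | mono _ ht ih =>
    obtain ⟨h⟩ := ih e cont hM
    exact ⟨h.toEvalsTo, h.steps_le_m.trans ht⟩

/-- The machine that runs `p` with input stack `k₀` and output stack `k₁`, with `r` as its initial
and its final register. -/
noncomputable def Prog.toFinTM2 [Finite K] [Finite σ] (p : Prog Γ σ) (k₀ k₁ : K) [Finite (Γ k₀)]
    (r : σ) : FinTM2 where
  kFin := .ofFinite K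
  k₀ := k₀
  k₁ := k₁
  Γ := Γ
  Λ := p.Pos
  main := p.entry
  ΛFin := .ofFinite p.Pos
  σ := σ
  initialState := r
  σFin := .ofFinite σ
  m := p.code id TM2.Stmt.halt
  Γk₀Fin := .ofFinite (Γ k₀)

theorem dite_cast_eq_update (k : K) (l : List (Γ k)) :
    (fun i => if h : i = k then by rw [h]; exact l else []) =
      Function.update (fun i => ([] : List (Γ i))) k l := by
  funext i
  rcases eq_or_ne i k with rfl | h <;> simp [*]

theorem tm2ComputableInPolyTime [Finite K] [Finite σ] {α β : Type} {k₀ k₁ : K}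
    [Finite (Γ k₀)] {ea : α → List (Γ k₀)} {eb : β → List (Γ k₁)} {f : α → β} (p : Prog Γ σ)
    (r : σ) (time : Polynomial ℕ)
    (hp : ∀ a, Runs p (r, Function.update (fun _ => []) k₀ (ea a))
      (r, Function.update (fun _ => []) k₁ (eb (f a))) (time.eval (ea a).length)) :
    Nonempty (TM2ComputableInPolyTime ea eb f) := by
  have outputs (a : α) (l : List (Γ k₀)) (l' : List (Γ k₁)) (hl : l = ea a) (hl' : l' = eb (f a)) :
      Nonempty (TM2OutputsInTime (p.toFinTM2 k₀ k₁ r) l (some l') (time.eval (ea a).length)) := by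
    subst hl hl'
    obtain ⟨h⟩ := (hp a).evalsToInTime id .halt fun _ => rfl
    simp only [← dite_cast_eq_update] at h
    exact ⟨h⟩
  exact ⟨{
    tm := p.toFinTM2 k₀ k₁ r
    inputAlphabet := Equiv.refl _
    outputAlphabet := Equiv.refl _
    time := time
    outputsFun := fun a => (outputs a _ _ (List.map_id _) (List.map_id _)).some }⟩

end StackProgram

/-! ### Addition of signed binary numbers -/

/-- The integer with the given binary digits in `{-1, 0, 1}`, the least significant one first. -/
def value (l : List SignType) : ℤ :=
  l.foldr (fun d z => d + 2 * z) 0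

theorem value_cons (d : SignType) (l : List SignType) : value (d :: l) = d + 2 * value l :=
  rfl

theorem value_eq_head_add_tail (l : List SignType) :
    value l = (l.head?.getD 0 : SignType) + 2 * value l.tail := by
  cases l <;> simp [value]

/-- A bit as a signed digit. -/
def bitDigit (b : Bool) : SignType :=
  bif b then 1 else 0

theorem value_map_bitDigit (l : List Bool) : value (l.map bitDigit) = ofBits l := by
  induction l with
  | nil => rfl
  | cons b l ih =>
    rw [List.map_cons, value_cons, ih, ofBits, ofBits, List.foldr_cons, Nat.bit_val]
    cases b <;> simp [bitDigit, add_comm]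

/-- The last nonzero digit of a signed binary number, or `s` if there is none. -/
def leadingDigit (s : SignType) (l : List SignType) : SignType :=
  l.foldl (fun s d => if d = 0 then s else d) s

theorem leadingDigit_eq (s : SignType) (l : List SignType) :
    leadingDigit s l = if value l = 0 then s else SignType.sign (value l) := by
  induction l generalizing s with
  | nil => rfl
  | cons d l ih =>
    rw [leadingDigit, List.foldl_cons, ← leadingDigit, ih, value_cons]
    rcases lt_trichotomy (value l) 0 with h | h | h
    · have : (d : ℤ) + 2 * value l < 0 := by cases d <;> simp <;> omega
      simp [h, h.ne, this, this.ne]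
    · cases d <;> simp [h]
    · have : 0 < (d : ℤ) + 2 * value l := by cases d <;> simp <;> omega
      simp [h, h.ne', this, this.ne']

theorem leadingDigit_zero_eq_one_iff (l : List SignType) : leadingDigit 0 l = 1 ↔ 0 < value l := by
  rw [leadingDigit_eq]
  split_ifs with h
  · simp [h]
  · exact sign_eq_one_iff

/-- The carries that occur in the computation of `p + u - 2 * v`. -/
abbrev Carry : Type :=
  Set.Icc (-4 : ℤ) 4

/-- The sum of a carry and a column of digits in the computation of `p + u - 2 * v`. -/
def columnSum (c : Carry) (p u v : SignType) : ℤ :=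
  c + p + u - 2 * v

/-- The digit to be written down for a column with sum `z`. Division with truncation makes the
carries decrease in absolute value after the operands have ended, so that they reach zero. -/
noncomputable def columnDigit (z : ℤ) : SignType :=
  SignType.sign (z.tmod 2)

theorem columnDigit_add_two_mul (z : ℤ) : (columnDigit z : ℤ) + 2 * z.tdiv 2 = z := by
  have hz : z.tmod 2 = -1 ∨ z.tmod 2 = 0 ∨ z.tmod 2 = 1 := by
    rw [Int.tmod_eq_emod]
    split_ifs <;> simp <;> omega
  have hcoe : (columnDigit z : ℤ) = z.tmod 2 := by
    rcases hz with h | h | h <;> simp [columnDigit, h]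
  rw [hcoe, Int.tmod_add_mul_tdiv]

theorem natAbs_columnSum_le (c : Carry) (p u v : SignType) : (columnSum c p u v).natAbs ≤ 8 := by
  have hdigit (d : SignType) : (-1 : ℤ) ≤ d ∧ (d : ℤ) ≤ 1 := by cases d <;> simp
  have := hdigit p
  have := hdigit u
  have := hdigit v
  have := c.2
  simp only [columnSum, Set.mem_Icc] at *
  omega

/-- The carry from a column. -/
def columnCarry (c : Carry) (p u v : SignType) : Carry :=
  ⟨(columnSum c p u v).tdiv 2, by
    have := natAbs_columnSum_le c p u v
    have : ((columnSum c p u v).tdiv 2).natAbs = (columnSum c p u v).natAbs / 2 :=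
      Int.natAbs_tdiv _ 2
    rw [Set.mem_Icc]
    omega⟩

theorem value_columns (c : Carry) (p u v : List SignType) :
    c + value p + value u - 2 * value v =
      columnDigit (columnSum c (p.head?.getD 0) (u.head?.getD 0) (v.head?.getD 0)) +
        2 * (columnCarry c (p.head?.getD 0) (u.head?.getD 0) (v.head?.getD 0) +
          value p.tail + value u.tail - 2 * value v.tail) := by
  have := columnDigit_add_two_mul
    (columnSum c (p.head?.getD 0) (u.head?.getD 0) (v.head?.getD 0))
  rw [value_eq_head_add_tail p, value_eq_head_add_tail u, value_eq_head_add_tail v]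
  simp only [columnCarry, columnSum] at *
  linarith

theorem natAbs_columnCarry_le {n : ℕ} {c : Carry} {p u v : List SignType}
    (hc : c.1.natAbs ≤ n + 1) (hp : p.length ≤ n - 3) (hu : u.length ≤ n - 3)
    (hv : v.length ≤ n - 3) :
    (columnCarry c (p.head?.getD 0) (u.head?.getD 0) (v.head?.getD 0)).1.natAbs ≤ n := by
  have hdigit {l : List SignType} (hl : l.length ≤ n - 3) :
      ((l.head?.getD 0 : SignType) : ℤ).natAbs ≤ min 1 (n - 3) := by
    rcases l with _ | ⟨d, l⟩
    · simp
    · have : 1 ≤ n - 3 := by rw [List.length_cons] at hl; omega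
      cases d <;> simp [this]
  have := hdigit hp
  have := hdigit hu
  have := hdigit hv
  have := c.2
  have hdiv : ((columnSum c (p.head?.getD 0) (u.head?.getD 0) (v.head?.getD 0)).tdiv 2).natAbs =
      (columnSum c (p.head?.getD 0) (u.head?.getD 0) (v.head?.getD 0)).natAbs / 2 :=
    Int.natAbs_tdiv _ 2
  rw [columnCarry, hdiv, columnSum]
  simp only [Set.mem_Icc, le_min_iff] at *
  omega

/-! ### The verifier as a stack machine -/

open StackProgram Function

/-- The letters on the work stacks: signed binary digits, and a separator `none`. -/
abbrev Letter := Option SignType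

/-- The work stacks: `x` and `y` hold the unread parts of the instance and of the certificate, `a`
and `b` the balances of earlier vertices that have and have not to be updated for the vertex being
read, `d` its own balance, `p`, `u` and `v` further operands of the adder, and `t` temporary
data. -/
inductive Work
  | x | y | a | b | d | p | t | u | v
  deriving DecidableEq

instance : Fintype Work :=
  ⟨{.x, .y, .a, .b, .d, .p, .t, .u, .v}, fun k => by cases k <;> decide⟩

/-- The stacks of the machine. -/
inductive Stack
  | inp | out | work (k : Work)
  deriving DecidableEq, Fintype

instance : Coe Work Stack :=
  ⟨Stack.work⟩

/-- The alphabets of the stacks. -/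
abbrev Alphabet : Stack → Type
  | .inp => Option (Option Bool ⊕ Option Bool)
  | .out => Bool
  | .work _ => Letter

/-- The contents of the stacks. -/
structure Mem where
  inp : List (Option (Option Bool ⊕ Option Bool)) := []
  out : List Bool := []
  x : List Letter := []
  y : List Letter := []
  a : List Letter := []
  b : List Letter := []
  d : List Letter := []
  p : List Letter := []
  t : List Letter := []
  u : List Letter := []
  v : List Letter := []

namespace Mem

/-- The contents of the stacks as a function. -/
def contents (m : Mem) : ∀ k, List (Alphabet k)
  | .inp => m.inp
  | .out => m.out
  | .work .x => m.x
  | .work .y => m.y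
  | .work .a => m.a
  | .work .b => m.b
  | .work .d => m.d
  | .work .p => m.p
  | .work .t => m.t
  | .work .u => m.u
  | .work .v => m.v

/-- Replaces the contents of one stack. -/
def set (m : Mem) : (k : Stack) → List (Alphabet k) → Mem
  | .inp, l => { m with inp := l }
  | .out, l => { m with out := l }
  | .work .x, l => { m with x := l }
  | .work .y, l => { m with y := l }
  | .work .a, l => { m with a := l }
  | .work .b, l => { m with b := l }
  | .work .d, l => { m with d := l }
  | .work .p, l => { m with p := l }
  | .work .t, l => { m with t := l }
  | .work .u, l => { m with u := l }
  | .work .v, l => { m with v := l }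

theorem update_contents (m : Mem) (k : Stack) (l : List (Alphabet k)) :
    update m.contents k l = (m.set k l).contents := by
  refine update_eq_iff.2 ⟨?_, ?_⟩
  · rcases k with _ | _ | _ | _ <;> rfl
  · rintro k' hk'
    rcases k with _ | _ | _ | _ <;> rcases k' with _ | _ | _ | _ <;>
      first | rfl | exact absurd rfl hk'

end Mem

/-- The register: whether the encodings have been well-formed so far, the letter read last, whether
the current number may be nonzero, the current digits and carries of the adder, and the last nonzero
digit of the balance being inspected. -/
structure Reg where
  ok : Bool
  cur : Option Letter := none
  edge : Bool := true
  p : Option SignType := none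
  d : Option SignType := none
  u : Option SignType := none
  v : Option SignType := none
  c₁ : Carry := ⟨0, by norm_num⟩
  c₂ : Carry := ⟨0, by norm_num⟩
  lead : SignType := 0

instance : Finite Reg :=
  .of_injective
    (fun r => (r.ok, r.cur, r.edge, r.p, r.d, r.u, r.v, r.c₁, r.c₂, r.lead))
    (by rintro ⟨⟩ ⟨⟩ h; simpa using h)

/-- The program state with the given register and contents of the stacks. -/
abbrev st (r : Reg) (m : Mem) : State Alphabet Reg :=
  (r, m.contents)

/-- The effect of an action in terms of `Mem`. -/
def exec : Reg × Mem → Act Alphabet Reg → Reg × Mem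
  | (r, m), .push k f => (r, m.set k (f r :: m.contents k))
  | (r, m), .peek k f => (f r (m.contents k).head?, m)
  | (r, m), .pop k f => (f r (m.contents k).head?, m.set k (m.contents k).tail)
  | (r, m), .load f => (f r, m)

theorem runs_block {l : List (Act Alphabet Reg)} {r r' : Reg} {m m' : Mem}
    (h : l.foldl exec (r, m) = (r', m')) : Runs (.block l) (st r m) (st r' m') 1 := by
  have hrun (l : List (Act Alphabet Reg)) (s : Reg × Mem) :
      l.foldl Act.run (st s.1 s.2) = st (l.foldl exec s).1 (l.foldl exec s).2 := by
    induction l generalizing s with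
    | nil => rfl
    | cons act l ih =>
      rw [List.foldl_cons, List.foldl_cons, ← ih]
      cases act <;> simp [Act.run, exec, Mem.update_contents]
  have hl := hrun l (r, m)
  rw [h] at hl
  exact hl ▸ .block l _

section Transfer

/-- Moves the letters of `src`, as transformed by `f`, to `dst` while `go` holds, and discards the
next letter. -/
def transfer (src : Stack) (f : Option (Alphabet src) → Option Letter) (go : Letter → Bool)
    (dst : Work) : Prog Alphabet Reg :=
  .loop (.block [.pop src fun r s => { r with cur := f s }]) (fun r => r.cur.any go)
    (.block [.push dst fun r => r.cur.getD none])

theorem runs_transfer_update (r : Reg) (S : ∀ k, List (Alphabet k)) {src : Stack} {dst : Work}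
    (hne : src ≠ dst)
    {f : Option (Alphabet src) → Option Letter} {go : Letter → Bool} {g : Alphabet src → Letter}
    {l rest : List (Alphabet src)} (hS : S src = l ++ rest)
    (hl : ∀ s ∈ l, f (some s) = some (g s) ∧ go (g s)) (hrest : (f rest.head?).any go = false) :
    Runs (transfer src f go dst) (r, S) ({ r with cur := f rest.head? },
      update (update S src rest.tail) dst ((l.map g).reverse ++ S dst)) (2 * l.length + 1) := by
  have hpop (r : Reg) (S : ∀ k, List (Alphabet k)) :
      Runs (.block [.pop src fun r s => { r with cur := f s }]) (r, S)
        ({ r with cur := f (S src).head? }, update S src (S src).tail) 1 := .block _ _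
  induction l generalizing r S with
  | nil =>
    have h := hpop r S
    rw [hS] at h
    have hupdate : update S src rest.tail =
        update (update S src rest.tail) dst ([].reverse ++ S dst) := by
      simp [hne.symm]
    exact hupdate ▸ .loop_exit h hrest
  | cons s l ih =>
    obtain ⟨⟨hs, hgo⟩, hl⟩ := List.forall_mem_cons.1 hl
    let r₁ : Reg := { r with cur := some (g s) }
    let S₁ := update (update S src (l ++ rest)) dst (g s :: S dst)
    have hhead : Runs (.block [.pop src fun r s => { r with cur := f s }]) (r, S)
        (r₁, update S src (l ++ rest)) 1 := by
      have h := hpop r S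
      rwa [hS, List.cons_append, List.head?_cons, List.tail_cons, hs] at h
    have hpush : Runs (Γ := Alphabet) (.block [.push dst fun r => r.cur.getD none])
        (r₁, update S src (l ++ rest)) (r₁, S₁) 1 := by
      have h := Runs.block (Γ := Alphabet) [.push dst fun r : Reg => r.cur.getD none]
        (r₁, update S src (l ++ rest))
      simpa [Act.run, r₁, S₁, hne.symm] using h
    have hloop := ih r₁ S₁ (by simp [S₁, hne]) hl
    have hupdate : update (update S₁ src rest.tail) dst ((l.map g).reverse ++ S₁ dst) =
        update (update S src rest.tail) dst (((s :: l).map g).reverse ++ S dst) := by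
      have hdst : S₁ dst = g s :: S dst := update_self ..
      rw [hdst, update_comm hne, update_idem, update_comm hne.symm, update_idem]
      simp
    rw [hupdate] at hloop
    exact (Runs.loop_step hhead hgo hpush hloop).mono (by rw [List.length_cons]; omega)

variable (r : Reg) (m : Mem)

theorem runs_transfer {src : Stack} {dst : Work} (hne : src ≠ dst)
    {f : Option (Alphabet src) → Option Letter} {go : Letter → Bool} {g : Alphabet src → Letter}
    {l rest : List (Alphabet src)} (hm : m.contents src = l ++ rest)
    (hl : ∀ s ∈ l, f (some s) = some (g s) ∧ go (g s)) (hrest : (f rest.head?).any go = false) :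
    Runs (transfer src f go dst) (st r m) (st { r with cur := f rest.head? }
      ((m.set src rest.tail).set dst ((l.map g).reverse ++ m.contents dst)))
      (2 * l.length + 1) := by
  have h := runs_transfer_update r m.contents hne hm hl hrest
  rwa [Mem.update_contents, Mem.update_contents] at h

/-- Moves all letters of `src` to `dst`. -/
def move (src dst : Work) : Prog Alphabet Reg :=
  transfer src id (fun _ => true) dst

theorem runs_move {src dst : Work} (hne : src ≠ dst) :
    Runs (move src dst) (st r m) (st { r with cur := none }
      ((m.set src []).set dst ((m.contents src).reverse ++ m.contents dst)))
      (2 * (m.contents src).length + 1) := by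
  have h := runs_transfer r m (src := src) (dst := dst) (by simpa using hne) (f := id)
    (go := fun _ => true) (g := id) (List.append_nil _).symm (by simp) rfl
  rwa [List.map_id] at h

theorem runs_move_reverse {src dst : Work} (hne : src ≠ dst) {l : List Letter}
    (hsrc : m.contents src = l.reverse) (hdst : m.contents dst = []) :
    Runs (move src dst) (st r m) (st { r with cur := none } ((m.set src []).set dst l))
      (2 * l.length + 1) := by
  have h := runs_move r m hne
  rwa [hsrc, hdst, List.reverse_reverse, List.append_nil, List.length_reverse] at h

/-- Moves the block at the top of `src` to `dst`, and discards the separator after it. -/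
def moveBlock (src dst : Work) : Prog Alphabet Reg :=
  transfer src id Option.isSome dst

theorem runs_moveBlock {src dst : Work} (hne : src ≠ dst) {b : List SignType} {rest : List Letter}
    (hm : m.contents src = b.map some ++ rest) (hrest : rest.head?.any Option.isSome = false) :
    Runs (moveBlock src dst) (st r m) (st { r with cur := rest.head? }
      ((m.set src rest.tail).set dst ((b.map some).reverse ++ m.contents dst)))
      (2 * b.length + 1) := by
  have h := runs_transfer r m (src := src) (dst := dst) (by simpa using hne) (f := id)
    (go := Option.isSome) (g := id) hm (by simp) hrest
  rwa [List.map_id, List.length_map] at h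

end Transfer

section Add

/-- Replaces the operands of the adder. -/
def Mem.setOperands (m : Mem) (p d u v : List SignType) : Mem :=
  { m with p := p.map some, d := d.map some, u := u.map some, v := v.map some }

/-- Moves the next column of digits from the operands of the adder to the register. -/
def popColumn : Prog Alphabet Reg :=
  .block [
    .pop Work.p fun r s => { r with p := s.join },
    .pop Work.d fun r s => { r with d := s.join },
    .pop Work.u fun r s => { r with u := s.join },
    .pop Work.v fun r s => { r with v := s.join }]

namespace Reg

/-- The sum of the current column in the computation of `p + u - 2 * v`. -/
def sum₁ (r : Reg) : ℤ :=
  columnSum r.c₁ (r.p.getD 0) (r.u.getD 0) (r.v.getD 0)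

/-- The sum of the current column in the computation of `d + v - 2 * u`. -/
def sum₂ (r : Reg) : ℤ :=
  columnSum r.c₂ (r.d.getD 0) (r.v.getD 0) (r.u.getD 0)

/-- Replaces the carries by those from the current column. -/
def carry (r : Reg) : Reg :=
  { r with
    c₁ := columnCarry r.c₁ (r.p.getD 0) (r.u.getD 0) (r.v.getD 0)
    c₂ := columnCarry r.c₂ (r.d.getD 0) (r.v.getD 0) (r.u.getD 0) }

end Reg

/-- Writes down the digits for the current column, and computes the carries. -/
noncomputable def pushColumn : Prog Alphabet Reg :=
  .block [
    .push Work.b fun r => some (columnDigit r.sum₁),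
    .push Work.t fun r => some (columnDigit r.sum₂),
    .load Reg.carry]

/-- Computes `p + u - 2 * v` on `b` and `d + v - 2 * u` on `t`, with the least significant digits at
the bottom. -/
noncomputable def add : Prog Alphabet Reg :=
  .loop popColumn
    (fun r => r.p.isSome || r.d.isSome || r.u.isSome || r.v.isSome || r.c₁.1 != 0 || r.c₂.1 != 0)
    pushColumn

theorem runs_popColumn (r : Reg) (m : Mem) (p d u v : List SignType) :
    Runs popColumn (st r (m.setOperands p d u v))
      (st { r with p := p.head?, d := d.head?, u := u.head?, v := v.head? }
        (m.setOperands p.tail d.tail u.tail v.tail)) 1 := by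
  have hjoin (l : List SignType) : ((l.map some).head?).join = l.head? := by
    cases l <;> rfl
  exact runs_block (by
    simp only [List.foldl_cons, List.foldl_nil, exec, Mem.contents, Mem.set, Mem.setOperands, hjoin,
      List.map_tail])

theorem runs_add_nil (r : Reg) (m : Mem) (h₁ : r.c₁.1 = 0) (h₂ : r.c₂.1 = 0) :
    Runs add (st r (m.setOperands [] [] [] []))
      (st { ok := r.ok, cur := r.cur, edge := r.edge, lead := r.lead }
        (m.setOperands [] [] [] [])) 1 := by
  have hr : ({ r with p := none, d := none, u := none, v := none } : Reg) =
      { ok := r.ok, cur := r.cur, edge := r.edge, lead := r.lead } := by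
    simp [Subtype.ext_iff, h₁, h₂]
  have hpop := runs_popColumn r m [] [] [] []
  simp only [List.head?_nil, List.tail_nil, hr] at hpop
  exact .loop_exit hpop rfl

theorem runs_add {n : ℕ} (r : Reg) (m : Mem) {p d u v : List SignType} (hp : p.length ≤ n - 4)
    (hd : d.length ≤ n - 4) (hu : u.length ≤ n - 4) (hv : v.length ≤ n - 4)
    (hc₁ : r.c₁.1.natAbs ≤ n) (hc₂ : r.c₂.1.natAbs ≤ n) :
    ∃ p' d' : List SignType, p'.length ≤ n ∧ d'.length ≤ n ∧
      value p' = r.c₁ + value p + value u - 2 * value v ∧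
      value d' = r.c₂ + value d + value v - 2 * value u ∧
      Runs add (st r (m.setOperands p d u v))
        (st { ok := r.ok, cur := r.cur, edge := r.edge, lead := r.lead }
          { m.setOperands [] [] [] [] with
            b := (p'.map some).reverse ++ m.b, t := (d'.map some).reverse ++ m.t })
        (2 * n + 1) := by
  induction n using Nat.strong_induction_on generalizing r m p d u v with
  | h n ih =>
  by_cases hdone : p = [] ∧ d = [] ∧ u = [] ∧ v = [] ∧ r.c₁.1 = 0 ∧ r.c₂.1 = 0
  · obtain ⟨rfl, rfl, rfl, rfl, h₁, h₂⟩ := hdone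
    exact ⟨[], [], by simp, by simp, by simp [value, h₁], by simp [value, h₂],
      (runs_add_nil r m h₁ h₂).mono (by omega)⟩
  obtain ⟨n, rfl⟩ : ∃ k, n = k + 1 :=
    Nat.exists_eq_succ_of_ne_zero fun hn => hdone (by simp_all)
  have hcontinue : (p.head?.isSome || d.head?.isSome || u.head?.isSome || v.head?.isSome ||
      r.c₁.1 != 0 || r.c₂.1 != 0) = true := by
    contrapose! hdone
    simpa [and_assoc] using hdone
  have htail {l : List SignType} (hl : l.length ≤ n + 1 - 4) : l.tail.length ≤ n - 4 := by
    rw [List.length_tail]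
    omega
  let r₁ : Reg := { r with p := p.head?, d := d.head?, u := u.head?, v := v.head? }
  let m₁ : Mem := { m with
    b := some (columnDigit r₁.sum₁) :: m.b, t := some (columnDigit r₁.sum₂) :: m.t }
  have hpush : Runs pushColumn (st r₁ (m.setOperands p.tail d.tail u.tail v.tail))
      (st r₁.carry (m₁.setOperands p.tail d.tail u.tail v.tail)) 1 :=
    runs_block rfl
  obtain ⟨p', d', hp', hd', hvp, hvd, hloop⟩ := ih n (Nat.lt_succ_self n) r₁.carry m₁
    (htail hp) (htail hd) (htail hu) (htail hv)
    (natAbs_columnCarry_le hc₁ hp hu hv) (natAbs_columnCarry_le hc₂ hd hv hu)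
  refine ⟨columnDigit r₁.sum₁ :: p', columnDigit r₁.sum₂ :: d', Nat.succ_le_succ hp',
    Nat.succ_le_succ hd', ?_, ?_, (Runs.loop_step
      (runs_popColumn r m p d u v) hcontinue hpush
      (?_ : Runs _ _ _ (2 * n + 1))).mono (by omega)⟩
  · rw [value_columns r.c₁ p u v, value_cons, hvp]
    rfl
  · rw [value_columns r.c₂ d v u, value_cons, hvd]
    rfl
  · simp only [List.map_cons, List.reverse_cons, List.append_assoc, List.singleton_append]
    exact hloop

end Add

/-- A letter of an encoding as a letter on the work stacks. -/
def toLetter : Option Bool → Letter :=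
  Option.map bitDigit

section ReadNumeral

/-- Checks the encoding of a number that has been moved to `t`. -/
def checkNumeral : Prog Alphabet Reg :=
  .block [.peek Work.t fun r s => { r with
    ok := r.ok && (r.cur == some none && s != some (some 0) && (r.edge || s.isNone)) }]

/-- Moves the number at the top of `src` to `dst`, and checks its encoding. -/
def readNumeral (src dst : Work) : Prog Alphabet Reg :=
  moveBlock src .t ⨾ checkNumeral ⨾ move .t dst

theorem runs_readNumeral (r : Reg) {m : Mem} {src dst : Work} (hne : src ≠ dst) (hsrc : src ≠ .t)
    (hdst : dst ≠ .t) {w : List (Option Bool)} (hw : m.contents src = w.map toLetter)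
    (ht : m.t = []) (hempty : m.contents dst = []) :
    Runs (readNumeral src dst) (st r m)
      (st { r with cur := none, ok := r.ok && numberOk r.edge w }
        ((m.set src ((afterNumber w).map toLetter)).set dst (((block w).map bitDigit).map some)))
      (4 * w.length + 3) := by
  have hmap : w.map toLetter =
      ((block w).map bitDigit).map some ++ (afterBlock w).map toLetter := by
    conv_lhs => rw [← map_some_block_append_afterBlock w]
    simp [toLetter]
  have hrest : ((afterBlock w).map toLetter).head?.any Option.isSome = false := by
    rw [List.head?_map, Option.any_map, ← any_isSome_head?_afterBlock w]
    congr 1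
    exact funext fun s => Option.isSome_map
  let r₁ : Reg := { r with cur := ((afterBlock w).map toLetter).head? }
  let r₂ : Reg := { r₁ with ok := r.ok && numberOk r.edge w }
  let m₁ := (m.set src ((afterNumber w).map toLetter)).set Work.t
    (((block w).map bitDigit).map some).reverse
  have hblock : Runs (moveBlock src .t) (st r m) (st r₁ m₁) (2 * (block w).length + 1) := by
    have h := runs_moveBlock r m hsrc (hw.trans hmap) hrest
    rwa [List.length_map, ← List.map_tail, show m.contents Work.t = [] from ht,
      List.append_nil] at h
  have hcheck : Runs checkNumeral (st r₁ m₁) (st r₂ m₁) 1 := by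
    have hcur : (r₁.cur == some none) = ((afterBlock w).head? == some none) := by
      simp only [r₁, List.head?_map]
      rcases (afterBlock w).head? with _ | _ | _ <;> rfl
    have htop : (m₁.contents Work.t).head? =
        (block w).getLast?.map fun b => some (bitDigit b) := by
      change (((block w).map bitDigit).map some).reverse.head? = _
      simp [Function.comp_def]
    have hnil : (block w).isEmpty = (block w).getLast?.isNone := by
      cases block w <;> rfl
    refine runs_block (Prod.ext ?_ rfl)
    simp only [List.foldl_cons, List.foldl_nil, exec, hcur, htop, r₂, numberOk, hnil]
    rcases (block w).getLast? with _ | _ | _ <;> rfl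
  have hmove : Runs (move .t dst) (st r₂ m₁) (st { r₂ with cur := none }
      ((m.set src ((afterNumber w).map toLetter)).set dst (((block w).map bitDigit).map some)))
      (2 * (block w).length + 1) := by
    have hm₁ : m₁.contents dst = [] := by
      rcases m
      cases src <;> cases dst <;> simp_all [Mem.set, Mem.contents, m₁]
    have hm : (m₁.set Work.t []).set dst (((block w).map bitDigit).map some) =
       (m.set src ((afterNumber w).map toLetter)).set dst (((block w).map bitDigit).map some) := by
      rcases m
      cases src <;> cases dst <;> simp_all [Mem.set, Mem.contents, m₁]
    have h := runs_move_reverse r₂ m₁ hdst.symm rfl hm₁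
    rwa [hm, List.length_map, List.length_map] at h
  have := length_block_add_length_afterBlock w
  exact (hblock.seq (hcheck.seq hmove)).mono (by omega)

end ReadNumeral

section ReadEntry

/-- Applies `f` to all balances. -/
def Tally.map {α β : Type} (f : α → β) (s : Tally α) : Tally β :=
  ⟨s.accs.map f, f s.own, s.x, s.y, s.ok⟩

/-- All numbers and words in a tally have length at most `N`. -/
structure Tally.Bounded (N : ℕ) (s : Tally (List SignType)) : Prop where
  accs : ∀ w ∈ s.accs, w.length ≤ N
  own : s.own.length ≤ N
  x : s.x.length ≤ N
  y : s.y.length ≤ N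

/-- A list of balances on a stack. -/
def encodeBalances (as : List (List SignType)) : List Letter :=
  as.flatMap fun w => w.map some ++ [none]

/-- The stacks that represent a tally, where the balances `as` remain to be updated. The updated
ones are in reverse order. -/
def Tally.mem (s : Tally (List SignType)) (as : List (List SignType)) : Mem where
  x := s.x.map toLetter
  y := s.y.map toLetter
  a := encodeBalances as
  b := (encodeBalances s.accs).reverse
  d := s.own.map some

/-- Reads an entry of the adjacency matrix. -/
def readEdge : Prog Alphabet Reg :=
  .block [.pop Work.x fun r s => { r with ok := r.ok && s.join.isSome, edge := s.join == some 1 }]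

/-- Reads the numbers of moves of an entry. -/
def readMoves : Prog Alphabet Reg :=
  readNumeral .y .u ⨾ readNumeral .y .v

/-- Completes the balance that has been written to `b`. -/
def endBalance : Prog Alphabet Reg :=
  .block [.push Work.b fun _ => none, .load fun r => { r with edge := true }]

/-- Updates the balances of the vertex being read and of an earlier vertex. -/
noncomputable def updateBalances : Prog Alphabet Reg :=
  moveBlock .a .t ⨾ move .t .p ⨾ add ⨾ endBalance ⨾ move .t .d

/-- Reads the entry for the vertex being read and an earlier vertex. -/
noncomputable def readEntry : Prog Alphabet Reg :=
  readEdge ⨾ readMoves ⨾ updateBalances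

variable (s : Tally (List SignType)) (as : List (List SignType))

theorem runs_readEdge (cur : Option Letter) :
    Runs readEdge (st { ok := s.ok, cur := cur } (s.mem as))
      (st { ok := s.ok && s.x.head?.join.isSome, cur := cur, edge := s.x.head?.join == some true }
        (Tally.mem { s with x := s.x.tail } as)) 1 := by
  obtain ⟨accs, own, x, y, ok⟩ := s
  exact runs_block (by rcases x with _ | ⟨_ | _ | _, x⟩ <;> rfl)

theorem runs_readMoves (ok edge : Bool) (cur : Option Letter) :
    Runs readMoves (st { ok := ok, cur := cur, edge := edge } (s.mem as))
      (st { ok := ok && numberOk edge s.y && numberOk edge (afterNumber s.y), edge := edge }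
        { Tally.mem { s with y := afterNumber (afterNumber s.y) } as with
          u := ((block s.y).map bitDigit).map some
          v := ((block (afterNumber s.y)).map bitDigit).map some })
      (8 * s.y.length + 6) := by
  let u := (block s.y).map bitDigit
  have hout : Runs (readNumeral .y .u) (st { ok := ok, cur := cur, edge := edge } (s.mem as))
      (st { ok := ok && numberOk edge s.y, edge := edge }
        { Tally.mem { s with y := afterNumber s.y } as with u := u.map some })
      (4 * s.y.length + 3) :=
    runs_readNumeral _ (by decide) (by decide) (by decide) rfl rfl rfl
  have hinc := runs_readNumeral (src := .y) (dst := .v)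
    { ok := ok && numberOk edge s.y, edge := edge }
    (m := { Tally.mem { s with y := afterNumber s.y } as with u := u.map some })
    (by decide) (by decide) (by decide) (w := afterNumber s.y) rfl rfl rfl
  have := length_afterNumber_le s.y
  exact (hout.seq hinc).mono (by omega)

variable {s}

theorem runs_updateBalances {N : ℕ} {w u v : List SignType} (hw : w.length ≤ N)
    (hs : s.own.length ≤ N) (hu : u.length ≤ N) (hv : v.length ≤ N) (ok edge : Bool) :
    ∃ a own : List SignType, a.length ≤ N + 4 ∧ own.length ≤ N + 4 ∧
      value a = value w + value u - 2 * value v ∧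
      value own = value s.own + value v - 2 * value u ∧
      Runs updateBalances
        (st { ok := ok, edge := edge } { s.mem (w :: as) with u := u.map some, v := v.map some })
        (st { ok := ok } (Tally.mem { s with accs := s.accs ++ [a], own := own } as))
        (8 * N + 21) := by
  obtain ⟨a, own, ha, hown, hva, hvown, hadd⟩ := runs_add (n := N + 4)
    { ok := ok, edge := edge } (s.mem as) hw hs hu hv (by simp) (by simp)
  let s' : Tally (List SignType) := { s with accs := s.accs ++ [a], own := own }
  have hblock : Runs (moveBlock .a .t)
      (st { ok := ok, edge := edge } { s.mem (w :: as) with u := u.map some, v := v.map some })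
      (st { ok := ok, cur := some none, edge := edge }
        { s.mem as with t := (w.map some).reverse ++ [], u := u.map some, v := v.map some })
      (2 * N + 1) :=
    (runs_moveBlock (b := w) (rest := none :: encodeBalances as) _ _ (by decide)
      (by simp [Mem.contents, Tally.mem, encodeBalances]) rfl).mono (by omega)
  have hmove : Runs (move .t .p)
      (st { ok := ok, cur := some none, edge := edge }
        { s.mem as with t := (w.map some).reverse ++ [], u := u.map some, v := v.map some })
      (st { ok := ok, edge := edge } ((s.mem as).setOperands w s.own u v)) (2 * N + 1) :=
    (runs_move_reverse (l := w.map some) _ _ (by decide) (List.append_nil _) rfl).mono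
      (by simpa using hw)
  have hend : Runs endBalance
      (st { ok := ok, edge := edge } { (s.mem as).setOperands [] [] [] [] with
        b := (a.map some).reverse ++ (s.mem as).b, t := (own.map some).reverse ++ (s.mem as).t })
      (st { ok := ok } { s'.mem as with d := [], t := (own.map some).reverse ++ [] }) 1 := by
    have hb : (encodeBalances s'.accs).reverse =
        none :: ((a.map some).reverse ++ (encodeBalances s.accs).reverse) := by
      simp [s', encodeBalances]
    simp only [Tally.mem, hb]
    exact runs_block rfl
  have hmove' : Runs (move .t .d)
      (st { ok := ok } { s'.mem as with d := [], t := (own.map some).reverse ++ [] })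
      (st { ok := ok } (s'.mem as)) (2 * N + 9) :=
    (runs_move_reverse (l := own.map some) _ _ (by decide) (List.append_nil _) rfl).mono
      (by rw [List.length_map]; omega)
  exact ⟨a, own, ha, hown, by simpa using hva, by simpa using hvown,
    (hblock.seq (hmove.seq (hadd.seq (hend.seq hmove')))).mono (by omega)⟩

theorem runs_readEntry {N : ℕ} (hs : s.Bounded N) {w : List SignType} (hw : w.length ≤ N)
    (cur : Option Letter) :
    ∃ s' : Tally (List SignType), s'.map value = (s.map value).entry (value w) ∧
      s'.Bounded (N + 4) ∧
      Runs readEntry (st { ok := s.ok, cur := cur } (s.mem (w :: as)))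
        (st { ok := s'.ok } (s'.mem as)) (16 * N + 28) := by
  let edge := s.x.head?.join == some true
  let y₁ := afterNumber s.y
  let s₁ : Tally (List SignType) := { s with x := s.x.tail }
  let s₂ : Tally (List SignType) := { s₁ with y := afterNumber y₁ }
  let ok := s.ok && s.x.head?.join.isSome && numberOk edge s.y && numberOk edge y₁
  have hy₁ : y₁.length ≤ N := (length_afterNumber_le _).trans hs.y
  obtain ⟨a, own, ha, hown, hva, hvown, hbalances⟩ := runs_updateBalances (s := s₂) as
    (u := (block s.y).map bitDigit) (v := (block y₁).map bitDigit) hw hs.own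
    (by simpa using (length_block_le s.y).trans hs.y)
    (by simpa using (length_block_le y₁).trans hy₁) ok edge
  let s' : Tally (List SignType) := { s₂ with accs := s.accs ++ [a], own := own, ok := ok }
  have hmap : s'.map value = (s.map value).entry (value w) := by
    simp only [value_map_bitDigit] at hva hvown
    simp only [Tally.map, s', List.map_append, List.map_cons, List.map_nil, hva, hvown]
    rfl
  have hbounded : s'.Bounded (N + 4) :=
    { accs := by
        simp only [s', List.mem_append, List.mem_singleton]
        rintro w' (hw' | rfl)
        exacts [(hs.accs w' hw').trans (Nat.le_add_right ..), ha]
      own := hown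
      x := (List.tail_sublist _).length_le.trans (hs.x.trans (Nat.le_add_right ..))
      y := (length_afterNumber_le _).trans (hy₁.trans (Nat.le_add_right ..)) }
  have := hs.y
  exact ⟨s', hmap, hbounded, ((runs_readEdge s _ cur).seq
    ((runs_readMoves s₁ _ _ edge cur).seq hbalances)).mono (by simp only [s₁]; omega)⟩

end ReadEntry

section ReadRow

/-- Looks at the top letter of a stack. -/
def peek (k : Work) : Prog Alphabet Reg :=
  .block [.peek k fun r s => { r with cur := s }]

theorem runs_peek (r : Reg) (m : Mem) (k : Work) :
    Runs (peek k) (st r m) (st { r with cur := (m.contents k).head? } m) 1 :=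
  runs_block rfl

/-- Reads the entries of a vertex. -/
noncomputable def readEntries : Prog Alphabet Reg :=
  .loop (peek .a) (fun r => r.cur.isSome) readEntry

/-- Reads the separator after the entries of a vertex. -/
def checkSeparator : Prog Alphabet Reg :=
  .block [.pop Work.x fun r s => { r with ok := r.ok && s == some none }]

/-- Finishes reading a vertex. -/
def endRow : Prog Alphabet Reg :=
  checkSeparator ⨾ move .d .b ⨾ endBalance ⨾ move .b .a

/-- Reads the part of the encodings for one vertex. -/
noncomputable def readRow : Prog Alphabet Reg :=
  readNumeral .x .d ⨾ readEntries ⨾ endRow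

/-- The stacks that represent a tally between the parts for two vertices. -/
def Tally.restMem (s : Tally (List SignType)) : Mem :=
  Tally.mem { s with accs := [], own := [] } s.accs

theorem Tally.Bounded.mono {N N' : ℕ} {s : Tally (List SignType)} (hs : s.Bounded N)
    (h : N ≤ N') : s.Bounded N' :=
  ⟨fun w hw => (hs.accs w hw).trans h, hs.own.trans h, hs.x.trans h, hs.y.trans h⟩

theorem runs_readEntries {as : List (List SignType)} {N : ℕ} (has : ∀ w ∈ as, w.length ≤ N)
    {s : Tally (List SignType)} (hs : s.Bounded N) (cur : Option Letter) :
    ∃ s' : Tally (List SignType), s'.map value = (as.map value).foldl Tally.entry (s.map value) ∧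
      s'.Bounded (N + 4 * as.length) ∧
      Runs readEntries (st { ok := s.ok, cur := cur } (s.mem as)) (st { ok := s'.ok } (s'.mem []))
        (as.length * (16 * (N + 4 * as.length) + 29) + 1) := by
  induction as generalizing N s cur with
  | nil => exact ⟨s, rfl, hs, (Runs.loop_exit (runs_peek _ _ _) rfl).mono (by simp)⟩
  | cons w as ih =>
    obtain ⟨hw, has⟩ := List.forall_mem_cons.1 has
    have hcur : (encodeBalances (w :: as)).head?.isSome := by
      simp [encodeBalances]
    obtain ⟨s₁, hs₁, hb₁, hentry⟩ := runs_readEntry as hs hw (encodeBalances (w :: as)).head?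
    obtain ⟨s', hs', hb', hloop⟩ :=
      ih (fun w' hw' => (has w' hw').trans (Nat.le_add_right N 4)) hb₁ none
    refine ⟨s', by rw [hs', hs₁]; rfl, hb'.mono (by rw [List.length_cons]; omega),
      (Runs.loop_step (runs_peek _ _ _) hcur hentry hloop).mono ?_⟩
    rw [List.length_cons]
    nlinarith

theorem length_encodeBalances_le {as : List (List SignType)} {N : ℕ}
    (has : ∀ w ∈ as, w.length ≤ N) : (encodeBalances as).length ≤ as.length * (N + 1) := by
  rw [encodeBalances, List.length_flatMap]
  exact (List.sum_le_card_nsmul _ (N + 1) (by simpa using has)).trans (by simp)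

theorem runs_endRow {N : ℕ} {s : Tally (List SignType)} (hs : s.Bounded N) :
    Runs endRow (st { ok := s.ok } (s.mem []))
      (st { ok := s.ok && s.x.head? == some none }
        (Tally.restMem ⟨s.accs ++ [s.own], [], s.x.tail, s.y, s.ok && s.x.head? == some none⟩))
      (2 * (s.accs.length + 2) * (N + 1) + 4) := by
  obtain ⟨accs, own, x, y, ok⟩ := s
  let r : Reg := { ok := ok && x.head? == some none }
  let s₁ : Tally (List SignType) := ⟨accs, own, x.tail, y, ok⟩
  have hpop : Runs checkSeparator
      (st { ok := ok } (Tally.mem ⟨accs, own, x, y, ok⟩ [])) (st r (s₁.mem [])) 1 :=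
    runs_block (by rcases x with _ | ⟨_ | _ | _, x⟩ <;> rfl)
  have hmove : Runs (move .d .b) (st r (s₁.mem [])) (st r { s₁.mem [] with
      d := [], b := (own.map some).reverse ++ (encodeBalances accs).reverse }) (2 * N + 1) :=
    (runs_move r (s₁.mem []) (src := .d) (dst := .b) (by decide)).mono
      (by simpa [Tally.mem, Mem.contents, s₁] using hs.own)
  have hpush : Runs endBalance (st r { s₁.mem [] with
      d := [], b := (own.map some).reverse ++ (encodeBalances accs).reverse })
      (st r { s₁.mem [] with d := [], b := (encodeBalances (accs ++ [own])).reverse }) 1 := by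
    have hb : (encodeBalances (accs ++ [own])).reverse =
        none :: ((own.map some).reverse ++ (encodeBalances accs).reverse) := by
      simp [encodeBalances]
    rw [hb]
    exact runs_block rfl
  have hmove' := runs_move_reverse (src := .b) (dst := .a) (l := encodeBalances (accs ++ [own])) r
    { s₁.mem [] with d := [], b := (encodeBalances (accs ++ [own])).reverse } (by decide) rfl rfl
  have hlen := length_encodeBalances_le (as := accs ++ [own]) (N := N) (by
    simp only [List.mem_append, List.mem_singleton]
    rintro w (hw | rfl)
    exacts [hs.accs w hw, hs.own])
  rw [List.length_append, List.length_singleton] at hlen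
  exact (hpop.seq (hmove.seq (hpush.seq hmove'))).mono (by simp only; linarith)

theorem runs_readRow {N : ℕ} {s : Tally (List SignType)} (hs : s.Bounded N) (hx : s.x ≠ [])
    (cur : Option Letter) :
    ∃ s' : Tally (List SignType), s'.map value = (s.map value).row ∧
      s'.Bounded (N + 4 * s.accs.length) ∧
      Runs readRow (st { ok := s.ok, cur := cur } s.restMem) (st { ok := s'.ok } s'.restMem)
        ((s.accs.length + 1) * (18 * (N + 4 * s.accs.length) + 31)) := by
  let s₁ : Tally (List SignType) :=
    ⟨[], (block s.x).map bitDigit, afterNumber s.x, s.y, s.ok && numberOk true s.x⟩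
  have hs₁ : s₁.Bounded N :=
    { accs := by simp [s₁]
      own := by simpa [s₁] using (length_block_le s.x).trans hs.x
      x := (length_afterNumber_le s.x).trans hs.x
      y := hs.y }
  have hnumeral : Runs (readNumeral .x .d) (st { ok := s.ok, cur := cur } s.restMem)
      (st { ok := s₁.ok } (s₁.mem s.accs)) (4 * s.x.length + 3) :=
    runs_readNumeral _ (by decide) (by decide) (by decide) rfl rfl rfl
  obtain ⟨s₂, hs₂, hb₂, hentries⟩ := runs_readEntries hs.accs hs₁ none
  have hlen : s₂.accs.length = s.accs.length := by
    have h := congrArg (·.accs.length) hs₂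
    simpa [Tally.map, Tally.length_accs_foldl_entry, s₁] using h
  let s' : Tally (List SignType) :=
    ⟨s₂.accs ++ [s₂.own], [], s₂.x.tail, s₂.y, s₂.ok && s₂.x.head? == some none⟩
  have hs' : s'.map value = (s.map value).row := by
    have hstart : s₁.map value = (s.map value).startRow := by
      simp only [s₁, Tally.map, Tally.startRow, value_map_bitDigit, List.map_nil, number]
    have hend : s'.map value = (s₂.map value).endRow := by
      simp only [s', Tally.map, Tally.endRow, List.map_append, List.map_cons, List.map_nil]
      rfl
    rw [hend, hs₂, hstart]
    exact (if_neg hx).symm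
  have hb' : s'.Bounded (N + 4 * s.accs.length) :=
    { accs := by
        simp only [s', List.mem_append, List.mem_singleton]
        rintro w (hw | rfl)
        exacts [hb₂.accs w hw, hb₂.own]
      own := Nat.zero_le _
      x := (List.tail_sublist _).length_le.trans hb₂.x
      y := hb₂.y }
  have := hs.x
  exact ⟨s', hs', hb', (hnumeral.seq (hentries.seq (runs_endRow hb₂))).mono
    (by rw [hlen]; nlinarith)⟩

/-- Reads the encodings vertex by vertex. -/
noncomputable def readRows : Prog Alphabet Reg :=
  .loop (peek .x) (fun r => r.cur.isSome) readRow

theorem runs_readRows {N K k : ℕ} {s : Tally (List SignType)} (hs : s.Bounded N)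
    (hx : s.x.length ≤ k) (hk : s.accs.length + k ≤ K) :
    ∃ s' : Tally (List SignType), s'.map value = Tally.row^[k] (s.map value) ∧
      s'.Bounded (N + 4 * K * k) ∧ s'.accs.length ≤ K ∧
      Runs readRows (st { ok := s.ok } s.restMem) (st { ok := s'.ok } s'.restMem)
        (k * (K * (18 * (N + 4 * K * k) + 31) + 1) + 1) := by
  induction k using Nat.strong_induction_on generalizing N s with | _ k ih
  have hpeek := runs_peek { ok := s.ok } s.restMem .x
  by_cases hnil : s.x = []
  · have hfixed : (s.map value).row = s.map value := if_pos hnil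
    have hcur : (s.restMem.contents Work.x).head? = none := by
      simp [Tally.restMem, Tally.mem, Mem.contents, hnil]
    rw [hcur] at hpeek
    exact ⟨s, (Function.iterate_fixed hfixed k).symm, hs.mono (Nat.le_add_right ..), by omega,
      (Runs.loop_exit hpeek rfl).mono (Nat.le_add_left ..)⟩
  have hcur : (s.restMem.contents Work.x).head?.isSome := by
    simpa [Tally.restMem, Tally.mem, Mem.contents, List.isSome_head?] using hnil
  obtain ⟨k, rfl⟩ := Nat.exists_eq_add_one.2 ((List.length_pos_of_ne_nil hnil).trans_le hx)
  obtain ⟨s₁, hs₁, hb₁, hrow⟩ := runs_readRow hs hnil (s.restMem.contents Work.x).head?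
  have hlen : s₁.accs.length = s.accs.length + 1 := by
    have h := Tally.length_accs_row (s := s.map value) hnil
    rw [← hs₁] at h
    simpa [Tally.map] using h
  have hx₁ : s₁.x.length < s.x.length := by
    have h := Tally.length_x_row_lt (s := s.map value) hnil
    rwa [← hs₁] at h
  obtain ⟨s', hs', hb', hlen', hloop⟩ := ih k k.lt_succ_self hb₁ (by omega) (by omega)
  have hN : N + 4 * s.accs.length + 4 * K * k ≤ N + 4 * K * (k + 1) := by
    rw [mul_add_one]
    omega
  refine ⟨s', by rw [hs', hs₁, Function.iterate_succ_apply], hb'.mono hN, hlen',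
    (Runs.loop_step hpeek hcur hrow hloop).mono ?_⟩
  have hone : (s.accs.length + 1) * (18 * (N + 4 * s.accs.length) + 31) ≤
      K * (18 * (N + 4 * K * (k + 1)) + 31) :=
    Nat.mul_le_mul (by omega) (by omega)
  have hrest : k * (K * (18 * (N + 4 * s.accs.length + 4 * K * k) + 31) + 1) ≤
      k * (K * (18 * (N + 4 * K * (k + 1)) + 31) + 1) := by
    gcongr
  rw [add_one_mul k]
  omega

end ReadRow

section Drain

/-- Removes all letters from a stack while `f` updates the register. -/
def drain (src : Work) (f : Reg → Option Letter → Reg) : Prog Alphabet Reg :=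
  .loop (.block [.pop src f]) (fun r => r.cur.isSome) (.block [])

theorem runs_drain {src : Work} {f : Reg → Option Letter → Reg} (hf : ∀ r s, (f r s).cur = s)
    (r : Reg) (m : Mem) :
    Runs (drain src f) (st r m)
      (st (f ((m.contents src).foldl (fun r s => f r (some s)) r) none) (m.set src []))
      (2 * (m.contents src).length + 1) := by
  have hpop (r : Reg) (m : Mem) : Runs (Γ := Alphabet) (.block [.pop src f]) (st r m)
      (st (f r (m.contents src).head?) (m.set src (m.contents src).tail)) 1 := runs_block rfl
  generalize hl : m.contents src = l
  induction l generalizing r m with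
  | nil =>
    have h := hpop r m
    rw [hl] at h
    exact .loop_exit h (by simp [hf])
  | cons s l ih =>
    have hhead : Runs (Γ := Alphabet) (.block [.pop src f]) (st r m)
        (st (f r (some s)) (m.set src l)) 1 := by
      have h := hpop r m
      rwa [hl] at h
    have hloop := ih (f r (some s)) (m.set src l) (by cases src <;> rfl)
    rw [show (m.set src l).set src [] = m.set src [] by cases src <;> rfl] at hloop
    exact (Runs.loop_step hhead (by simp [hf]) (runs_block rfl) hloop).mono
      (by rw [List.length_cons]; omega)

/-- Checks that the certificate has been read entirely. -/
def Reg.checkEnd (r : Reg) (s : Option Letter) : Reg :=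
  { r with cur := s, ok := r.ok && s.isNone }

theorem Reg.checkEnd_foldl (l : List Letter) (ok : Bool) (cur : Option Letter) :
    (l.foldl (fun r s => checkEnd r (some s)) { ok := ok, cur := cur }).checkEnd none =
      { ok := ok && l.isEmpty } := by
  induction l generalizing ok cur with
  | nil => rfl
  | cons s l ih => exact (ih _ _).trans (by simp)

/-- Checks that a balance is positive. -/
def Reg.checkPos (r : Reg) : Option Letter → Reg
  | none => { r with cur := none }
  | some none => { r with cur := some none, ok := r.ok && r.lead == 1, lead := 0 }
  | some (some d) => { r with cur := some (some d), lead := if d = 0 then r.lead else d }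

theorem Reg.checkPos_foldl_some (w : List SignType) (r : Reg) (s : Option Letter) :
    ((w.map some).foldl (fun r s => checkPos r (some s)) r).checkPos s =
      checkPos { r with lead := leadingDigit r.lead w } s := by
  induction w generalizing r with
  | nil => rfl
  | cons d w ih =>
    rw [List.map_cons, List.foldl_cons, ih]
    rcases s with _ | _ | _ <;> rfl

theorem Reg.checkPos_foldl_encodeBalances (as : List (List SignType)) (ok : Bool)
    (cur : Option Letter) :
    ((encodeBalances as).foldl (fun r s => checkPos r (some s)) { ok := ok, cur := cur }).checkPos
      none = { ok := ok && as.all (0 < value ·) } := by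
  induction as generalizing ok cur with
  | nil => simp [encodeBalances, checkPos]
  | cons w as ih =>
    have hw : (w.map some ++ [none]).foldl (fun r s => checkPos r (some s))
        { ok := ok, cur := cur } = { ok := ok && decide (0 < value w), cur := some none } := by
      rw [List.foldl_append, List.foldl_cons, List.foldl_nil, checkPos_foldl_some,
        ← decide_eq_decide.2 (leadingDigit_zero_eq_one_iff w)]
      rfl
    rw [encodeBalances, List.flatMap_cons, List.foldl_append, hw, ← encodeBalances, ih]
    simp [Bool.and_assoc]

end Drain

section Verifier

/-- A letter of the first word of the input as a letter on the work stacks. -/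
def firstLetter (s : Option (Alphabet .inp)) : Option Letter :=
  (s.join.bind Sum.getLeft?).map toLetter

/-- A letter of the second word of the input as a letter on the work stacks. -/
def secondLetter (s : Option (Alphabet .inp)) : Option Letter :=
  (s.join.bind Sum.getRight?).map toLetter

/-- Moves the two words of the input to the stacks `x` and `y`. -/
def readInput : Prog Alphabet Reg :=
  transfer .inp firstLetter (fun _ => true) .t ⨾ transfer .inp secondLetter (fun _ => true) .b ⨾
  move .t .x ⨾ move .b .y

theorem runs_readInput (x y : List (Option Bool)) :
    Runs readInput (st { ok := true } { inp := encodePair (x, y) })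
      (st { ok := true } (Tally.restMem ⟨[], [], x, y, true⟩))
      (4 * (encodePair (x, y)).length) := by
  have hleft : Runs (transfer .inp firstLetter (fun _ => true) .t)
      (st { ok := true } { inp := encodePair (x, y) })
      (st { ok := true }
        { inp := y.map fun b => some (.inr b), t := (x.map toLetter).reverse ++ [] })
      (2 * x.length + 1) := by
    have h := runs_transfer { ok := true } { inp := encodePair (x, y) } (src := .inp) (dst := .t)
      (by decide) (f := firstLetter) (go := fun _ => true)
      (g := fun s => (s.bind Sum.getLeft?).elim none toLetter) (l := x.map fun a => some (.inl a))
      rfl (by simp [firstLetter]) rfl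
    rwa [List.map_map, List.length_map] at h
  have hright : Runs (transfer .inp secondLetter (fun _ => true) .b)
      (st { ok := true }
        { inp := y.map fun b => some (.inr b), t := (x.map toLetter).reverse ++ [] })
      (st { ok := true }
        { t := (x.map toLetter).reverse ++ [], b := (y.map toLetter).reverse ++ [] })
      (2 * y.length + 1) := by
    have h := runs_transfer { ok := true }
      { inp := y.map fun b => some (.inr b), t := (x.map toLetter).reverse ++ [] }
      (src := .inp) (dst := .b)
      (by decide) (f := secondLetter) (go := fun _ => true)
      (g := fun s => (s.bind Sum.getRight?).elim none toLetter) (l := y.map fun a => some (.inr a))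
      (List.append_nil _).symm (by simp [secondLetter]) rfl
    rwa [List.map_map, List.length_map] at h
  have hx : Runs (move .t .x)
      (st { ok := true }
        { t := (x.map toLetter).reverse ++ [], b := (y.map toLetter).reverse ++ [] })
      (st { ok := true } { x := x.map toLetter, b := (y.map toLetter).reverse ++ [] })
      (2 * (x.map toLetter).length + 1) :=
    runs_move_reverse _ _ (by decide) (List.append_nil _) rfl
  have hy : Runs (move .b .y)
      (st { ok := true } { x := x.map toLetter, b := (y.map toLetter).reverse ++ [] })
      (st { ok := true } (Tally.restMem ⟨[], [], x, y, true⟩)) (2 * (y.map toLetter).length + 1) :=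
    runs_move_reverse _ _ (by decide) (List.append_nil _) rfl
  exact (hleft.seq (hright.seq (hx.seq hy))).mono (by
    simp only [encodePair, List.length_append, List.length_map, List.length_cons]
    omega)

/-- Writes the result to the output. -/
def writeOutput : Prog Alphabet Reg :=
  .block [.push .out fun r => r.ok, .load fun _ => { ok := true }]

/-- Checks a tally after the instance has been read, and writes the result to the output. -/
def checkTally : Prog Alphabet Reg :=
  drain .y Reg.checkEnd ⨾ drain .a Reg.checkPos ⨾ writeOutput

theorem runs_checkTally {N : ℕ} {s : Tally (List SignType)} (hs : s.Bounded N) (hx : s.x = []) :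
    Runs checkTally (st { ok := s.ok } s.restMem) (st { ok := true }
      { out := [s.ok && s.y.isEmpty && s.accs.all (0 < value ·)] })
      (2 * (N + s.accs.length * (N + 1)) + 3) := by
  have hend : Runs (drain .y Reg.checkEnd) (st { ok := s.ok } s.restMem)
      (st { ok := s.ok && s.y.isEmpty } { a := encodeBalances s.accs }) (2 * s.y.length + 1) := by
    have h := runs_drain (src := .y) (f := Reg.checkEnd) (fun _ _ => rfl) { ok := s.ok } s.restMem
    rw [Reg.checkEnd_foldl] at h
    simpa [Tally.restMem, Tally.mem, Mem.contents, Mem.set, hx, encodeBalances] using h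
  have hpos := runs_drain (src := .a) (f := Reg.checkPos) (by rintro _ (_ | _ | _) <;> rfl)
    { ok := s.ok && s.y.isEmpty } { a := encodeBalances s.accs }
  simp only [Mem.contents, Reg.checkPos_foldl_encodeBalances] at hpos
  have := length_encodeBalances_le hs.accs
  have := hs.y
  exact (hend.seq (hpos.seq (runs_block rfl))).mono (by omega)

/-- The verifier as a program for the stack machine. -/
noncomputable def verifier : Prog Alphabet Reg :=
  readInput ⨾ readRows ⨾ checkTally

/-- A bound on the running time of the verifier. -/
noncomputable def verifierTime : Polynomial ℕ :=
  72 * .X ^ 4 + 26 * .X ^ 3 + 41 * .X ^ 2 + 9 * .X + 4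

theorem runs_verifier (x y : List (Option Bool)) :
    Runs verifier (st { ok := true } { inp := encodePair (x, y) })
      (st { ok := true } { out := [verify x y] })
      (verifierTime.eval (encodePair (x, y)).length) := by
  let s : Tally (List SignType) := ⟨[], [], x, y, true⟩
  have hinput := runs_readInput x y
  have hL : x.length + y.length ≤ (encodePair (x, y)).length := by
    simp [encodePair]
  generalize (encodePair (x, y)).length = L at hL hinput ⊢
  have hs : s.Bounded L :=
    ⟨by simp [s], Nat.zero_le _, (Nat.le_add_right ..).trans hL, (Nat.le_add_left ..).trans hL⟩
  obtain ⟨s', hs', hb', hk, hrows⟩ := runs_readRows hs le_rfl (K := x.length) (by simp [s])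
  have hx' : s'.x = [] := by
    have h := Tally.x_iterate_row (k := x.length) (s := s.map value) le_rfl
    rwa [← hs'] at h
  have hverify : verify x y = (s'.ok && s'.y.isEmpty && s'.accs.all (0 < value ·)) := by
    rw [verify, show ⟨[], 0, x, y, true⟩ = s.map value from rfl, ← hs']
    simp only [Tally.map, List.all_map]
    rfl
  rw [hverify]
  have hxL : x.length ≤ L := hs.x
  have hcheck := runs_checkTally (hb'.mono (N' := L + 4 * L * L) (by gcongr)) hx'
  refine (hinput.seq (hrows.seq hcheck)).mono ?_
  calc _ ≤ 4 * L + (L * (L * (18 * (L + 4 * L * L) + 31) + 1) + 1 +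
        (2 * (L + 4 * L * L + L * (L + 4 * L * L + 1)) + 3)) := by
        gcongr
        exact hk.trans hxL
    _ = verifierTime.eval L := by
        simp only [verifierTime, Polynomial.eval_add, Polynomial.eval_mul, Polynomial.eval_pow,
          Polynomial.eval_X, Polynomial.eval_ofNat]
        ring

end Verifier

theorem polyTimeDecidable_moveCountCertificate : PolyTimeDecidable MoveCountCertificate := by
  refine ⟨fun w => verify w.1 w.2, verify_iff, ?_⟩
  have hempty : (fun _ => []) = ({} : Mem).contents := by
    funext k
    rcases k with _ | _ | k <;> first | rfl | (cases k <;> rfl)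
  refine tm2ComputableInPolyTime (k₀ := .inp) (k₁ := .out) verifier
    { ok := true } verifierTime fun w => ?_
  rw [hempty, Mem.update_contents, Mem.update_contents]
  exact runs_verifier w.1 w.2

theorem isPolyVerifier_moveCountCertificate :
    IsPolyVerifier MoveCountCertificate coverSolvability := by
  refine ⟨polyTimeDecidable_moveCountCertificate, ?_, .X * (.X * (2 * (.X + 1))), ?_⟩
  · rintro _ _ ⟨m, G, C, n, rfl, rfl, hn⟩
    exact ⟨m, G, C, rfl, hn.coverSolvable⟩
  · rintro _ ⟨m, G, C, rfl, hC⟩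
    obtain ⟨n, hn⟩ := hC.exists_isMoveCount
    refine ⟨encodeMoves n, ?_, m, G, C, n, rfl, rfl, hn⟩
    simpa using hn.length_encodeMoves_le

theorem corollary8 :
    coverSolvability ∈ NP (Option Bool) ∧
      IsPolyVerifier MoveCountCertificate coverSolvability :=
  ⟨⟨Option Bool, inferInstance, MoveCountCertificate, isPolyVerifier_moveCountCertificate⟩,
    isPolyVerifier_moveCountCertificate⟩
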